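/- Let $Z_0$ be the empty word and $Z_k=Z_{k-1}\,k\,Z_{k-1}$ for $k\ge 1$ (the Zimin words). Let $\pi$ be a pattern of length $n$, that is, a non-empty sequence of variables, in which $m$ distinct variables occur, given as numbers $0,\dots,m-1$. Let $R$ be a ranking function that assigns to each variable of $\pi$ a positive integer, and let $k$ be its largest value. A \emph{ranked occurrence} of $\pi$ in $Z_k$ is a map $h$ from the variables to non-empty words such that $h(\pi)$ is a factor of $Z_k$ and, for each variable $x$, the largest letter of $h(x)$ is $R(x)$. For a word $u$ let $\mathrm{compress}(u)$ be the word obtained from $u$ by deleting every letter that has a larger letter somewhere to its left and a larger letter somewhere to its right. The computation model is a random access machine with finitely many registers and arrays, on which assignment, addition, subtraction, comparison and array access cost one step each. Space is the number of memory words occupied, including input and output, and each word holds a number bounded by a constant multiple of the space bound. \textbf{Theorem.} (a) There is a program that, given $\pi$ and $R$, decides whether $\pi$ has a ranked occurrence in $Z_k$, simultaneously in time $O(nk)$ and space $O(n+k^2)$. (b) There is a program that, given $\pi$ and $R$, outputs the words $\mathrm{compress}(h(x))$, for all variables $x$ of $\pi$, of some ranked occurrence $h$ of $\pi$ in $Z_k$,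 or reports that no ranked occurrence exists, simultaneously in time $O(nk)$ and space $O(n+mk)$. In particular, the space is $O(n+k^2)$ if $m\le k$. -/

import Mathlib

namespace RankedZimin

/-! ### Zimin words, ranked occurrences, compressed words -/

/-- The Zimin words `Z_1 = 1`, `Z_k = Z_{k-1} k Z_{k-1}` (with `Z_0` the empty word). -/
def zimin : ℕ → List ℕ
  | 0 => []
  | k + 1 => zimin k ++ (k + 1) :: zimin k

/-- `h` is a non-erasing valuation of the variables such that `h(pat)` is a factor of `Z_k` and
such that the rank of each variable `x`, that is, the largest letter of `h x`, is `R x`. -/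
structure IsRankedOccurrence {m : ℕ} (pat : List (Fin m)) (R : Fin m → ℕ) (k : ℕ)
    (h : Fin m → List ℕ) : Prop where
  nonerasing : ∀ x, h x ≠ []
  rank_eq : ∀ x, IsGreatest {a | a ∈ h x} (R x)
  factor : pat.flatMap h <:+: zimin k

/-- Deletes from the word the letters `a` that have a larger letter somewhere to the left and a
larger letter somewhere to the right; `left` holds the letters that were already passed. -/
def compressAux (left : List ℕ) : List ℕ → List ℕ
  | [] => []
  | a :: right =>
    if (∃ b ∈ left, a < b) ∧ (∃ b ∈ right, a < b) then compressAux (a :: left) right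
    else a :: compressAux (a :: left) right

/-- The compressed representation of a word: all letters that have a larger letter both to
the left and to the right are removed. -/
def compress (u : List ℕ) : List ℕ := compressAux [] u

/-! ### A random access machine with unit cost

A program uses finitely many registers and finitely many arrays, both named by numbers. When it
runs with memory parameter `N`, each array has the cells `0, …, N - 1`, and every register and
every cell holds one of the numbers `0, …, N` (an operation that would leave these ranges has no
execution). So a number takes one machine word of logarithmically many bits. -/

/-- Programs. The instructions act on registers `x y z` and on arrays `a`. -/
inductive Cmd where
  /-- do nothing -/
  | skip : Cmd
  /-- `x := c` -/
  | const (x c : ℕ) : Cmd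
  /-- `x := y` -/
  | copy (x y : ℕ) : Cmd
  /-- `x := y + z` -/
  | add (x y z : ℕ) : Cmd
  /-- `x := y - z`, truncated at `0` -/
  | sub (x y z : ℕ) : Cmd
  /-- `x := a[y]` -/
  | load (x a y : ℕ) : Cmd
  /-- `a[x] := y` -/
  | store (a x y : ℕ) : Cmd
  /-- `c ; d` -/
  | seq (c d : Cmd) : Cmd
  /-- `if x < y then c else d` -/
  | ite (x y : ℕ) (c d : Cmd) : Cmd
  /-- `while x < y do c` -/
  | loop (x y : ℕ) (c : Cmd) : Cmd

/-- Contents of the registers and of the arrays. -/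
structure State where
  reg : ℕ → ℕ
  mem : ℕ → ℕ → ℕ

/-- Put `v` into the register `x`. -/
def State.setReg (s : State) (x v : ℕ) : State :=
  { s with reg := Function.update s.reg x v }

/-- Put `v` into the cell `i` of the array `a`. -/
def State.setMem (s : State) (a i v : ℕ) : State :=
  { s with mem := Function.update s.mem a (Function.update (s.mem a) i v) }

/-- The state can be stored in a machine with memory parameter `N`. -/
def State.Fits (N : ℕ) (s : State) : Prop :=
  (∀ x, s.reg x ≤ N) ∧ (∀ a i, s.mem a i ≤ N) ∧ (∀ a i, N ≤ i → s.mem a i = 0)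

/-- `Exec N c s t s'`: with memory parameter `N`, the program `c` started in the state `s` halts
in the state `s'` after `t` steps. Each elementary instruction and each test is one step. -/
inductive Exec (N : ℕ) : Cmd → State → ℕ → State → Prop where
  | skip (s : State) : Exec N .skip s 1 s
  | const (s : State) (x c : ℕ) (hc : c ≤ N) : Exec N (.const x c) s 1 (s.setReg x c)
  | copy (s : State) (x y : ℕ) : Exec N (.copy x y) s 1 (s.setReg x (s.reg y))
  | add (s : State) (x y z : ℕ) (h : s.reg y + s.reg z ≤ N) :
      Exec N (.add x y z) s 1 (s.setReg x (s.reg y + s.reg z))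
  | sub (s : State) (x y z : ℕ) : Exec N (.sub x y z) s 1 (s.setReg x (s.reg y - s.reg z))
  | load (s : State) (x a y : ℕ) (h : s.reg y < N) :
      Exec N (.load x a y) s 1 (s.setReg x (s.mem a (s.reg y)))
  | store (s : State) (a x y : ℕ) (h : s.reg x < N) :
      Exec N (.store a x y) s 1 (s.setMem a (s.reg x) (s.reg y))
  | seq {c d : Cmd} {s s' s'' : State} {t t' : ℕ} (h : Exec N c s t s')
      (h' : Exec N d s' t' s'') : Exec N (.seq c d) s (t + t') s''
  | ite_true {x y : ℕ} {c d : Cmd} {s s' : State} {t : ℕ} (hxy : s.reg x < s.reg y)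
      (h : Exec N c s t s') : Exec N (.ite x y c d) s (t + 1) s'
  | ite_false {x y : ℕ} {c d : Cmd} {s s' : State} {t : ℕ} (hxy : ¬ s.reg x < s.reg y)
      (h : Exec N d s t s') : Exec N (.ite x y c d) s (t + 1) s'
  | loop_true {x y : ℕ} {c : Cmd} {s s' s'' : State} {t t' : ℕ} (hxy : s.reg x < s.reg y)
      (h : Exec N c s t s') (h' : Exec N (.loop x y c) s' t' s'') :
      Exec N (.loop x y c) s (t + t' + 1) s''
  | loop_false {x y : ℕ} {c : Cmd} {s : State} (hxy : ¬ s.reg x < s.reg y) :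
      Exec N (.loop x y c) s 1 s

/-- The registers that occur in a program. -/
def Cmd.regs : Cmd → Finset ℕ
  | .skip => ∅
  | .const x _ => {x}
  | .copy x y => {x, y}
  | .add x y z => {x, y, z}
  | .sub x y z => {x, y, z}
  | .load x _ y => {x, y}
  | .store _ x y => {x, y}
  | .seq c d => c.regs ∪ d.regs
  | .ite x y c d => {x, y} ∪ (c.regs ∪ d.regs)
  | .loop x y c => {x, y} ∪ c.regs

/-- The arrays that occur in a program. -/
def Cmd.arrays : Cmd → Finset ℕ
  | .skip => ∅
  | .const _ _ => ∅
  | .copy _ _ => ∅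
  | .add _ _ _ => ∅
  | .sub _ _ _ => ∅
  | .load _ a _ => {a}
  | .store a _ _ => {a}
  | .seq c d => c.arrays ∪ d.arrays
  | .ite _ _ c d => c.arrays ∪ d.arrays
  | .loop _ _ c => c.arrays

/-- The number of machine words that a program occupies when it runs with memory parameter `N`:
all its registers and all cells of all its arrays (input and output included). -/
def Cmd.space (c : Cmd) (N : ℕ) : ℕ := c.regs.card + c.arrays.card * N

/-- Started in the state `s`, the program `c` halts after at most `T` steps, using at most `S`
words of memory, in the state `s'`. -/
def Cmd.RunsWithin (c : Cmd) (T S : ℕ) (s s' : State) : Prop :=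
  ∃ N t, s.Fits N ∧ Exec N c s t s' ∧ t ≤ T ∧ c.space N ≤ S

/-! ### Input and output -/

/-- The input: register `0` holds the length of the pattern, register `1` the number of variables,
array `0` the pattern and array `1` the ranks of the variables; all the rest is `0`. -/
def inputState {m : ℕ} (pat : List (Fin m)) (R : Fin m → ℕ) : State where
  reg := fun x => if x = 0 then pat.length else if x = 1 then m else 0
  mem := fun a i =>
    if a = 0 then (pat.map Fin.val).getD i 0
    else if a = 1 then (List.ofFn R).getD i 0
    else 0

/-- The words `v 0, …, v (m - 1)` over the positive integers, written one after the other, each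
of them followed by the end marker `0`. -/
def encodeWords {m : ℕ} (v : Fin m → List ℕ) : List ℕ :=
  (List.finRange m).flatMap fun x => v x ++ [0]

/-- The array `a` starts with the list `l`. -/
def State.Holds (s : State) (a : ℕ) (l : List ℕ) : Prop :=
  ∀ i, ∀ hi : i < l.length, s.mem a i = l[i]

end RankedZimin

open RankedZimin

/-! For `i ≤ k`, deleting the letters below `i` from `Z_k` leaves a Zimin word in which every second
letter is `i`. In a ranked occurrence, the values of the variables of rank at least `i`, reduced in
the same way, are non-empty and concatenate to an alternating word. So for neighbours `x y` in the
reduced pattern, exactly one of "`x` ends with `i`" and "`y` begins with `i`" holds, and a variable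
of rank `i` both begins and ends with `i`. These constraints are `Solves`;
`IsRankedOccurrence.exists_solves` shows that they are necessary on each level.

Conversely, solutions of the levels can be combined freely. A value of rank `r` is built from the
letter `r` by wrapping it with `r - 1, …, 1` as the solutions say. An alternating word is a factor
of the larger Zimin word as soon as its part without `i` is a factor of the smaller one
(`Alternating.isInfix`), so induction over the levels gives an occurrence (`isInfix_ziminFrom`).
Each letter that a wrapping puts inside stands between larger letters, so compression keeps only the
letters put at the two ends (`compress_buildWord`).

One level is a reachability problem on the gaps of the reduced pattern: a gap is marked if the
letter `i` next to it belongs to the variable on its left. Marks spread among the gaps before all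
occurrences of one variable, and among the gaps behind them. The least closed set that contains the
gaps behind the variables of rank `i` gives a solution if and only if it avoids the gaps before them
(`Consistent.solves`, `Solves.consistent`).

If the occurrences of each variable form a cyclic list, every gap has at most two successors, and a
search with a queue finds the least set in time `O(n)`. The `k` levels take time `O(nk)` and reuse
the same arrays. The construction also stores two bits per variable and level and writes at most
`2k` numbers per variable. This costs `O(mk)` in time and space, where `m ≤ n` because every
variable occurs. -/

namespace RankedZimin

set_option linter.unusedSimpArgs false

/-! ### Weakest preconditions with a time budget -/

/-- Started in the state `s`, the program halts within the time budget `b`, and the final state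
and the rest of the budget satisfy `Q`. -/
def wp (N : ℕ) (c : Cmd) (Q : State → ℕ → Prop) (s : State) (b : ℕ) : Prop :=
  ∃ t s', Exec N c s t s' ∧ t ≤ b ∧ Q s' (b - t)

/-- Started in the state `s`, the program halts within the time `T` in a state that satisfies
`Q`. -/
def Run (N : ℕ) (c : Cmd) (s : State) (T : ℕ) (Q : State → Prop) : Prop :=
  ∃ t s', Exec N c s t s' ∧ t ≤ T ∧ Q s'

/-- Does the program contain an assignment to the register `z`? -/
def Cmd.writesReg (z : ℕ) : Cmd → Bool
  | .skip => false
  | .const x _ => x == z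
  | .copy x _ => x == z
  | .add x _ _ => x == z
  | .sub x _ _ => x == z
  | .load x _ _ => x == z
  | .store _ _ _ => false
  | .seq c d => c.writesReg z || d.writesReg z
  | .ite _ _ c d => c.writesReg z || d.writesReg z
  | .loop _ _ c => c.writesReg z

/-- Does the program contain an assignment to a cell of the array `z`? -/
def Cmd.writesMem (z : ℕ) : Cmd → Bool
  | .store a _ _ => a == z
  | .seq c d => c.writesMem z || d.writesMem z
  | .ite _ _ c d => c.writesMem z || d.writesMem z
  | .loop _ _ c => c.writesMem z
  | _ => false

/-- The states agree wherever the program makes no assignment. -/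
structure Frame (c : Cmd) (s s' : State) : Prop where
  reg : ∀ x, c.writesReg x = false → s'.reg x = s.reg x
  mem : ∀ a, c.writesMem a = false → s'.mem a = s.mem a

theorem Frame.refl (c : Cmd) (s : State) : Frame c s s := ⟨fun _ _ => rfl, fun _ _ => rfl⟩

theorem Frame.trans {c : Cmd} {s s' s'' : State} (h : Frame c s s') (h' : Frame c s' s'') :
    Frame c s s'' :=
  ⟨fun x hx => (h'.reg x hx).trans (h.reg x hx), fun a ha => (h'.mem a ha).trans (h.mem a ha)⟩

@[simp] theorem State.setReg_reg (s : State) (x v y : ℕ) :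
    (s.setReg x v).reg y = if y = x then v else s.reg y := by
  simp [State.setReg, Function.update_apply]

@[simp] theorem State.setReg_mem (s : State) (x v : ℕ) : (s.setReg x v).mem = s.mem := rfl

@[simp] theorem State.setMem_reg (s : State) (a i v : ℕ) : (s.setMem a i v).reg = s.reg := rfl

@[simp] theorem State.setMem_mem (s : State) (a i v a' : ℕ) :
    (s.setMem a i v).mem a' = if a' = a then Function.update (s.mem a) i v else s.mem a' := by
  by_cases h : a' = a <;> simp [State.setMem, Function.update_apply, h]

/-- Lets loop invariants and subprogram specifications mention only what changes: that a given
program leaves a register or an array alone is decided from its text. -/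
theorem Exec.frame {N : ℕ} {c : Cmd} {s s' : State} {t : ℕ} (h : Exec N c s t s') :
    Frame c s s' := by
  induction h with
  | skip s => exact Frame.refl _ _
  | const s x c hc =>
    exact ⟨fun y hy => by simp [Cmd.writesReg] at hy; simp [Ne.symm hy], fun _ _ => rfl⟩
  | copy s x y =>
    exact ⟨fun y hy => by simp [Cmd.writesReg] at hy; simp [Ne.symm hy], fun _ _ => rfl⟩
  | add s x y z h =>
    exact ⟨fun y hy => by simp [Cmd.writesReg] at hy; simp [Ne.symm hy], fun _ _ => rfl⟩
  | sub s x y z =>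
    exact ⟨fun y hy => by simp [Cmd.writesReg] at hy; simp [Ne.symm hy], fun _ _ => rfl⟩
  | load s x a y h =>
    exact ⟨fun y hy => by simp [Cmd.writesReg] at hy; simp [Ne.symm hy], fun _ _ => rfl⟩
  | store s a x y h =>
    exact ⟨fun _ _ => rfl, fun y hy => by simp [Cmd.writesMem] at hy; simp [Ne.symm hy]⟩
  | seq _ _ ih ih' =>
    refine ⟨fun x hx => ?_, fun a ha => ?_⟩
    · simp only [Cmd.writesReg, Bool.or_eq_false_iff] at hx
      exact (ih'.reg x hx.2).trans (ih.reg x hx.1)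
    · simp only [Cmd.writesMem, Bool.or_eq_false_iff] at ha
      exact (ih'.mem a ha.2).trans (ih.mem a ha.1)
  | ite_true _ _ ih =>
    refine ⟨fun x hx => ?_, fun a ha => ?_⟩
    · simp only [Cmd.writesReg, Bool.or_eq_false_iff] at hx
      exact ih.reg x hx.1
    · simp only [Cmd.writesMem, Bool.or_eq_false_iff] at ha
      exact ih.mem a ha.1
  | ite_false _ _ ih =>
    refine ⟨fun x hx => ?_, fun a ha => ?_⟩
    · simp only [Cmd.writesReg, Bool.or_eq_false_iff] at hx
      exact ih.reg x hx.2
    · simp only [Cmd.writesMem, Bool.or_eq_false_iff] at ha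
      exact ih.mem a ha.2
  | loop_true _ _ _ ih ih' =>
    exact ⟨fun x hx => (ih'.reg x hx).trans (ih.reg x hx),
      fun a ha => (ih'.mem a ha).trans (ih.mem a ha)⟩
  | loop_false _ => exact Frame.refl _ _

section rules

variable {N : ℕ} {Q : State → ℕ → Prop} {s : State} {b : ℕ}

theorem wp_skip : wp N .skip Q s b ↔ 1 ≤ b ∧ Q s (b - 1) := by
  constructor
  · rintro ⟨t, s', h, ht, hQ⟩
    cases h
    exact ⟨ht, hQ⟩
  · rintro ⟨hb, hQ⟩
    exact ⟨1, _, .skip _, hb, hQ⟩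

theorem wp_const {x v : ℕ} :
    wp N (.const x v) Q s b ↔ v ≤ N ∧ 1 ≤ b ∧ Q (s.setReg x v) (b - 1) := by
  constructor
  · rintro ⟨t, s', h, ht, hQ⟩
    cases h with
    | const _ _ _ hc => exact ⟨hc, ht, hQ⟩
  · rintro ⟨hc, hb, hQ⟩
    exact ⟨1, _, .const _ _ _ hc, hb, hQ⟩

theorem wp_copy {x y : ℕ} :
    wp N (.copy x y) Q s b ↔ 1 ≤ b ∧ Q (s.setReg x (s.reg y)) (b - 1) := by
  constructor
  · rintro ⟨t, s', h, ht, hQ⟩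
    cases h
    exact ⟨ht, hQ⟩
  · rintro ⟨hb, hQ⟩
    exact ⟨1, _, .copy _ _ _, hb, hQ⟩

theorem wp_add {x y z : ℕ} :
    wp N (.add x y z) Q s b ↔
      s.reg y + s.reg z ≤ N ∧ 1 ≤ b ∧ Q (s.setReg x (s.reg y + s.reg z)) (b - 1) := by
  constructor
  · rintro ⟨t, s', h, ht, hQ⟩
    cases h with
    | add _ _ _ _ hc => exact ⟨hc, ht, hQ⟩
  · rintro ⟨hc, hb, hQ⟩
    exact ⟨1, _, .add _ _ _ _ hc, hb, hQ⟩

theorem wp_sub {x y z : ℕ} :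
    wp N (.sub x y z) Q s b ↔ 1 ≤ b ∧ Q (s.setReg x (s.reg y - s.reg z)) (b - 1) := by
  constructor
  · rintro ⟨t, s', h, ht, hQ⟩
    cases h
    exact ⟨ht, hQ⟩
  · rintro ⟨hb, hQ⟩
    exact ⟨1, _, .sub _ _ _ _, hb, hQ⟩

theorem wp_load {x a y : ℕ} :
    wp N (.load x a y) Q s b ↔
      s.reg y < N ∧ 1 ≤ b ∧ Q (s.setReg x (s.mem a (s.reg y))) (b - 1) := by
  constructor
  · rintro ⟨t, s', h, ht, hQ⟩
    cases h with
    | load _ _ _ _ hc => exact ⟨hc, ht, hQ⟩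
  · rintro ⟨hc, hb, hQ⟩
    exact ⟨1, _, .load _ _ _ _ hc, hb, hQ⟩

theorem wp_store {a x y : ℕ} :
    wp N (.store a x y) Q s b ↔
      s.reg x < N ∧ 1 ≤ b ∧ Q (s.setMem a (s.reg x) (s.reg y)) (b - 1) := by
  constructor
  · rintro ⟨t, s', h, ht, hQ⟩
    cases h with
    | store _ _ _ _ hc => exact ⟨hc, ht, hQ⟩
  · rintro ⟨hc, hb, hQ⟩
    exact ⟨1, _, .store _ _ _ _ hc, hb, hQ⟩

theorem wp_seq {c d : Cmd} : wp N (.seq c d) Q s b ↔ wp N c (wp N d Q) s b := by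
  constructor
  · rintro ⟨t, s', h, ht, hQ⟩
    cases h with
    | @seq _ _ _ s₁ _ t₁ t₂ h₁ h₂ =>
      exact ⟨t₁, s₁, h₁, by omega, t₂, s', h₂, by omega, by rwa [Nat.sub_sub]⟩
  · rintro ⟨t₁, s₁, h₁, ht₁, t₂, s₂, h₂, ht₂, hQ⟩
    exact ⟨t₁ + t₂, s₂, .seq h₁ h₂, by omega, by rwa [← Nat.sub_sub]⟩

theorem wp_ite {x y : ℕ} {c d : Cmd} :
    wp N (.ite x y c d) Q s b ↔ 1 ≤ b ∧
      (s.reg x < s.reg y → wp N c Q s (b - 1)) ∧ (s.reg y ≤ s.reg x → wp N d Q s (b - 1)) := by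
  constructor
  · rintro ⟨t, s', h, ht, hQ⟩
    cases h with
    | @ite_true _ _ _ _ _ _ t hxy h =>
      exact ⟨by omega, fun _ => ⟨t, s', h, by omega, by rwa [Nat.sub_sub, Nat.add_comm]⟩,
        fun h => absurd hxy (by omega)⟩
    | @ite_false _ _ _ _ _ _ t hxy h =>
      exact ⟨by omega, fun h => absurd h hxy,
        fun _ => ⟨t, s', h, by omega, by rwa [Nat.sub_sub, Nat.add_comm]⟩⟩
  · rintro ⟨hb, h₁, h₂⟩
    by_cases hxy : s.reg x < s.reg y
    · obtain ⟨t, s', h, ht, hQ⟩ := h₁ hxy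
      exact ⟨t + 1, s', .ite_true hxy h, by omega, by rwa [Nat.add_comm, ← Nat.sub_sub]⟩
    · obtain ⟨t, s', h, ht, hQ⟩ := h₂ (by omega)
      exact ⟨t + 1, s', .ite_false hxy h, by omega, by rwa [Nat.add_comm, ← Nat.sub_sub]⟩

/-- A loop with an invariant. As each test costs time, the budget makes the loop terminate. -/
theorem wp_loop {x y : ℕ} {c : Cmd} (Inv : State → ℕ → Prop) (h0 : Inv s b)
    (hstep : ∀ s' b', Frame c s s' → Inv s' b' → s'.reg x < s'.reg y →
      1 ≤ b' ∧ wp N c Inv s' (b' - 1))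
    (hexit : ∀ s' b', Frame c s s' → Inv s' b' → s'.reg y ≤ s'.reg x →
      1 ≤ b' ∧ Q s' (b' - 1)) :
    wp N (.loop x y c) Q s b := by
  suffices H : ∀ b' s', Frame c s s' → Inv s' b' → wp N (.loop x y c) Q s' b' from
    H b s (Frame.refl _ _) h0
  intro b'
  induction b' using Nat.strong_induction_on with
  | _ b' ih =>
    intro s' hf hi
    by_cases hxy : s'.reg x < s'.reg y
    · obtain ⟨hb, t, s₁, h₁, ht, hi₁⟩ := hstep s' b' hf hi hxy
      obtain ⟨t₂, s₂, h₂, ht₂, hQ⟩ := ih (b' - 1 - t) (by omega) s₁ (hf.trans h₁.frame) hi₁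
      refine ⟨t + t₂ + 1, s₂, .loop_true hxy h₁ h₂, by omega, ?_⟩
      have : b' - (t + t₂ + 1) = b' - 1 - t - t₂ := by omega
      rwa [this]
    · obtain ⟨hb, hQ⟩ := hexit s' b' hf hi (by omega)
      exact ⟨1, s', .loop_false hxy, hb, hQ⟩

theorem Run.of_wp {c : Cmd} {T : ℕ} {P : State → Prop} (h : wp N c (fun s' _ => P s') s T) :
    Run N c s T P := by
  obtain ⟨t, s', h, ht, hQ⟩ := h
  exact ⟨t, s', h, ht, hQ⟩

/-- The rule for calling a verified subprogram; its frame comes for free, and at most `T` of the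
budget is spent. -/
theorem Run.wp {c : Cmd} {T : ℕ} {P : State → Prop} (h : Run N c s T P) (hb : T ≤ b)
    (hQ : ∀ s' b', Frame c s s' → b ≤ b' + T → P s' → Q s' b') : wp N c Q s b := by
  obtain ⟨t, s', h, ht, hP⟩ := h
  exact ⟨t, s', h, by omega, hQ _ _ h.frame (by omega) hP⟩

end rules

/-! ### Zimin words over the letters from `i` on -/

/-- The Zimin word over the `d` letters `i, i + 1, …, i + d - 1`. -/
def ziminFrom (i : ℕ) : ℕ → List ℕ
  | 0 => []
  | d + 1 => ziminFrom i d ++ (d + i) :: ziminFrom i d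

theorem ziminFrom_one (k : ℕ) : ziminFrom 1 k = zimin k := by
  induction k with
  | zero => rfl
  | succ k ih => rw [ziminFrom, zimin, ih]

theorem le_of_mem_ziminFrom {i d a : ℕ} (h : a ∈ ziminFrom i d) : i ≤ a := by
  induction d with
  | zero => simp [ziminFrom] at h
  | succ d ih =>
    simp only [ziminFrom, List.mem_append, List.mem_cons] at h
    rcases h with h | rfl | h
    · exact ih h
    · omega
    · exact ih h

/-- The word in which the letter `i` is inserted after each letter. -/
def follow (i : ℕ) (u : List ℕ) : List ℕ := u.flatMap fun a => [a, i]

theorem follow_append (i : ℕ) (u v : List ℕ) : follow i (u ++ v) = follow i u ++ follow i v :=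
  List.flatMap_append

@[simp] theorem follow_cons (i a : ℕ) (u : List ℕ) : follow i (a :: u) = a :: i :: follow i u :=
  rfl

@[simp] theorem follow_nil (i : ℕ) : follow i [] = [] := rfl

/-- The definition splits the word at its largest letter; the levels need this recursion at the
smallest one. -/
theorem ziminFrom_succ (i d : ℕ) :
    ziminFrom i (d + 1) = i :: follow i (ziminFrom (i + 1) d) := by
  induction d with
  | zero => simp [ziminFrom]
  | succ d ih =>
    rw [ziminFrom, ih, ziminFrom, follow_append, follow_cons]
    simp [Nat.add_assoc, Nat.add_comm 1 i]

/-- Of each two consecutive letters of the word, exactly one is `i`. -/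
def Alternating (i : ℕ) (u : List ℕ) : Prop := u.IsChain fun a b => a = i ↔ b ≠ i

theorem alternating_cons_follow {i : ℕ} {u : List ℕ} (h : ∀ a ∈ u, i < a) :
    Alternating i (i :: follow i u) := by
  induction u with
  | nil => simp [Alternating]
  | cons a u ih =>
    have h1 : a ≠ i := (h a (by simp)).ne'
    have := ih fun b hb => h b (by simp [hb])
    simp only [Alternating, follow_cons, List.isChain_cons_cons] at this ⊢
    exact ⟨by simp [h1], by simp [h1], this⟩

theorem alternating_ziminFrom (i d : ℕ) : Alternating i (ziminFrom i d) := by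
  cases d with
  | zero => simp [Alternating, ziminFrom]
  | succ d =>
    rw [ziminFrom_succ]
    exact alternating_cons_follow fun a ha => le_of_mem_ziminFrom ha

theorem filter_follow {i : ℕ} {u : List ℕ} (h : ∀ a ∈ u, i < a) :
    (follow i u).filter (i < ·) = u := by
  induction u with
  | nil => rfl
  | cons a u ih => simp [h a (by simp), ih fun b hb => h b (by simp [hb])]

theorem filter_ziminFrom (i d : ℕ) :
    (ziminFrom i d).filter (i < ·) = ziminFrom (i + 1) (d - 1) := by
  cases d with
  | zero => rfl
  | succ d =>
    rw [ziminFrom_succ, List.filter_cons_of_neg (by simp),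
      filter_follow fun a ha => le_of_mem_ziminFrom ha, Nat.add_sub_cancel]

theorem filter_zimin (k i : ℕ) : (zimin k).filter (i < ·) = ziminFrom (i + 1) (k - i) := by
  induction i with
  | zero =>
    rw [← ziminFrom_one, List.filter_eq_self.2 fun a ha => by
      simpa [Nat.one_le_iff_ne_zero, Nat.pos_iff_ne_zero] using le_of_mem_ziminFrom ha]
    rfl
  | succ i ih =>
    -- The letters are deleted one at a time, the smallest first.
    rw [show k - (i + 1) = k - i - 1 by omega, ← filter_ziminFrom, ← ih, List.filter_filter]
    congr 1
    ext a
    simp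
    omega

/-- An alternating word is determined by its letters other than `i` and by whether `i` stands at
each end. Only a prefix is claimed because `follow` always ends with `i` on non-empty words, while
`u` need not. -/
theorem Alternating.isPrefix {i : ℕ} {u : List ℕ} (h : Alternating i u) :
    (u.head? = some i → u <+: i :: follow i (u.filter (· ≠ i))) ∧
      (u.head? ≠ some i → u <+: follow i (u.filter (· ≠ i))) := by
  induction u with
  | nil => simp
  | cons a u ih =>
    have ih := ih h.tail
    have hhead : u.head? = none → u = [] := by simp
    have hnext : ∀ b, u.head? = some b → (a = i ↔ b ≠ i) := by
      intro b hb
      cases u with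
      | nil => simp at hb
      | cons c u =>
        simp only [List.head?_cons, Option.some.injEq] at hb
        subst hb
        exact (List.isChain_cons_cons.1 h).1
    constructor
    · intro ha
      simp only [List.head?_cons, Option.some.injEq] at ha
      subst ha
      rw [List.filter_cons_of_neg (by simp), List.prefix_cons_inj]
      refine ih.2 fun hu => ?_
      simpa using hnext _ hu
    · intro ha
      have hai : a ≠ i := by simpa using ha
      rw [List.filter_cons_of_pos (by simpa using hai), follow_cons, List.prefix_cons_inj]
      cases u with
      | nil => simp
      | cons c u =>
        have hc : c = i := by
          by_contra hc
          exact hai ((hnext c rfl).2 hc)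
        exact ih.1 (by simp [hc])

/-- Every letter of `v` has an `i` on both sides in `i :: follow i v`, so there is room for the `i`
at either end of `u`. -/
theorem Alternating.isInfix {i : ℕ} {u v : List ℕ} (h : Alternating i u)
    (huv : u.filter (· ≠ i) <:+: v) : u <:+: i :: follow i v := by
  have h1 : u <:+: i :: follow i (u.filter (· ≠ i)) := by
    by_cases hu : u.head? = some i
    · exact (h.isPrefix.1 hu).isInfix
    · exact (h.isPrefix.2 hu).isInfix.trans (List.suffix_cons _ _).isInfix
  refine h1.trans ?_
  have h2 : ∀ p w : List ℕ, i :: follow i w <:+: i :: follow i (p ++ w) := by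
    intro p w
    refine List.IsSuffix.isInfix ?_
    induction p with
    | nil => exact List.suffix_refl _
    | cons a p ih =>
      exact ih.trans ⟨[i, a], by simp⟩
  obtain ⟨p, q, rfl⟩ := huv
  rw [List.append_assoc]
  refine List.IsInfix.trans (List.IsPrefix.isInfix ?_) (h2 p _)
  rw [follow_append]
  exact List.prefix_append (i :: follow i _) _

/-! ### The solvability of the levels is necessary -/

/-- The functions `b` and `e` tell consistently which values of variables, reduced to the
letters from `i` on, begin and end with `i`. -/
structure Solves {α : Type*} (pat : List α) (R : α → ℕ) (i : ℕ) (b e : α → Bool) : Prop where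
  chain : (pat.filter (i ≤ R ·)).IsChain fun x y => e x ≠ b y
  rank : ∀ x ∈ pat, R x = i → b x = true ∧ e x = true

theorem IsRankedOccurrence.exists_solves {m k : ℕ} {pat : List (Fin m)} {R : Fin m → ℕ}
    {h : Fin m → List ℕ} (H : IsRankedOccurrence pat R k h) (i : ℕ) :
    ∃ b e, Solves pat R (i + 1) b e := by
  have hne : ∀ x, i < R x → (h x).filter (i < ·) ≠ [] := by
    intro x hx h0
    simpa [hx] using List.filter_eq_nil_iff.1 h0 _ (H.rank_eq x).1
  -- Values of rank at most `i` vanish, so only the reduced pattern contributes.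
  have hfil : (pat.flatMap h).filter (i < ·) =
      (((pat.filter (i + 1 ≤ R ·)).map fun x => (h x).filter (i < ·))).flatten := by
    rw [List.filter_flatMap]
    generalize pat = l
    induction l with
    | nil => rfl
    | cons x l ih =>
      by_cases hx : i + 1 ≤ R x
      · rw [List.filter_cons_of_pos (by simpa using hx), List.flatMap_cons, ih]
        rfl
      · have h0 : (h x).filter (i < ·) = [] := by
          refine List.filter_eq_nil_iff.2 fun a ha => ?_
          have := (H.rank_eq x).2 ha
          simp
          omega
        rw [List.filter_cons_of_neg (by simpa using hx), List.flatMap_cons, ih, h0, List.nil_append]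
  have halt : Alternating (i + 1) ((pat.flatMap h).filter (i < ·)) := by
    refine (alternating_ziminFrom (i + 1) (k - i)).infix ?_
    rw [← filter_zimin]
    exact H.factor.filter _
  refine ⟨fun x => decide (((h x).filter (i < ·)).head? = some (i + 1)),
    fun x => decide (((h x).filter (i < ·)).getLast? = some (i + 1)), ?_, ?_⟩
  -- As the blocks are non-empty, alternation relates the last letter of each block to the first
  -- letter of the next.
  · rw [hfil, Alternating, List.isChain_flatten] at halt
    · have := (List.isChain_map _).1 halt.2
      have hall : ∀ x ∈ pat.filter (i + 1 ≤ R ·), i < R x := by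
        intro x hx
        simpa using (List.mem_filter.1 hx).2
      rw [List.isChain_iff_getElem] at this ⊢
      intro j hj
      have hj' := this j hj
      set x := (pat.filter (i + 1 ≤ R ·))[j] with hx
      set y := (pat.filter (i + 1 ≤ R ·))[j + 1] with hy
      have hx0 := hne x (hall _ (List.getElem_mem _))
      have hy0 := hne y (hall _ (List.getElem_mem _))
      have := hj' _ (List.getLast?_eq_some_getLast hx0) _ (List.head?_eq_some_head hy0)
      rw [List.getLast?_eq_some_getLast hx0, List.head?_eq_some_head hy0]
      simp only [Option.some.injEq, ne_eq, decide_eq_decide]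
      tauto
    · simp only [List.mem_map, not_exists, not_and]
      intro x hx
      exact hne x (by simpa using (List.mem_filter.1 hx).2)
  · intro x _ hx
    -- The surviving letters of a value of rank `i + 1` are larger than `i` and at most `i + 1`.
    have hall : ∀ a ∈ (h x).filter (i < ·), a = i + 1 := by
      intro a ha
      have h1 := (H.rank_eq x).2 (List.mem_filter.1 ha).1
      have h2 : i < a := by simpa using (List.mem_filter.1 ha).2
      omega
    have hx0 := hne x (by omega)
    simp only [decide_eq_true_eq]
    rw [List.getLast?_eq_some_getLast hx0, List.head?_eq_some_head hx0]
    exact ⟨congrArg some (hall _ (List.head_mem _)), congrArg some (hall _ (List.getLast_mem _))⟩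

/-! ### Words built from the letters at their ends -/

/-- Inserts the letter `i` between consecutive letters, and appends it if `e` holds. -/
def interleave (i : ℕ) (e : Bool) : List ℕ → List ℕ
  | [] => []
  | [a] => a :: if e then [i] else []
  | a :: b :: w => a :: i :: interleave i e (b :: w)

theorem interleave_cons_ne_nil {i : ℕ} {e : Bool} {a : ℕ} {w : List ℕ} (hw : w ≠ []) :
    interleave i e (a :: w) = a :: i :: interleave i e w := by
  obtain ⟨b, w, rfl⟩ := List.exists_cons_of_ne_nil hw
  rfl

theorem head?_interleave (i : ℕ) (e : Bool) (w : List ℕ) :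
    (interleave i e w).head? = w.head? := by
  match w with
  | [] => rfl
  | [a] => rfl
  | a :: b :: w => rfl

theorem mem_interleave {i : ℕ} {e : Bool} {w : List ℕ} {a : ℕ} :
    a ∈ interleave i e w → a = i ∨ a ∈ w := by
  induction w with
  | nil => simp [interleave]
  | cons c w ih =>
    rcases eq_or_ne w [] with rfl | hw
    · cases e <;> simp +contextual [interleave, or_comm]
    · rw [interleave_cons_ne_nil hw]
      simp only [List.mem_cons]
      tauto

theorem filter_interleave {i : ℕ} {e : Bool} {w : List ℕ} (h : ∀ a ∈ w, i < a) :
    (interleave i e w).filter (· ≠ i) = w := by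
  induction w with
  | nil => rfl
  | cons c w ih =>
    have hc : c ≠ i := (h c (by simp)).ne'
    rcases eq_or_ne w [] with rfl | hw
    · cases e <;> simp [interleave, hc]
    · rw [interleave_cons_ne_nil hw, List.filter_cons_of_pos (by simpa using hc),
        List.filter_cons_of_neg (by simp), ih fun a ha => h a (by simp [ha])]

theorem subset_interleave {i : ℕ} {e : Bool} {w : List ℕ} : w ⊆ interleave i e w := by
  induction w with
  | nil => simp
  | cons c w ih =>
    rcases eq_or_ne w [] with rfl | hw
    · simp [interleave]
    · rw [interleave_cons_ne_nil hw]
      intro a ha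
      rcases List.mem_cons.1 ha with rfl | ha
      · simp
      · simp [ih ha]

theorem alternating_cons_interleave {i : ℕ} {e : Bool} {w : List ℕ} (h : ∀ a ∈ w, i < a) :
    Alternating i (i :: interleave i e w) := by
  induction w with
  | nil => simp [Alternating, interleave]
  | cons c w ih =>
    have hc : c ≠ i := (h c (by simp)).ne'
    rcases eq_or_ne w [] with rfl | hw
    · cases e <;> simp [Alternating, interleave, hc]
    · have := ih fun a ha => h a (by simp [ha])
      rw [interleave_cons_ne_nil hw]
      simp only [Alternating, List.isChain_cons_cons] at this ⊢
      exact ⟨by simp [hc], by simp [hc], this⟩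

theorem getLast?_interleave {i : ℕ} {e : Bool} {w : List ℕ} (hw : w ≠ []) (h : ∀ a ∈ w, i < a) :
    (interleave i e w).getLast? = some i ↔ e = true := by
  induction w with
  | nil => exact absurd rfl hw
  | cons c w ih =>
    have hc : c ≠ i := (h c (by simp)).ne'
    rcases eq_or_ne w [] with rfl | hw
    · cases e <;> simp [interleave, hc]
    · rw [← ih hw fun a ha => h a (by simp [ha]), interleave_cons_ne_nil hw]
      obtain ⟨b, w, rfl⟩ := List.exists_cons_of_ne_nil hw
      have : interleave i e (b :: w) ≠ [] := fun h0 => by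
        have := head?_interleave i e (b :: w)
        simp [h0] at this
      obtain ⟨c', w', h'⟩ := List.exists_cons_of_ne_nil this
      rw [h']
      simp

/-- The word `w` with the letter `i` inserted between consecutive letters, and put in front of it
or behind it as `b` and `e` say. -/
def wrap (i : ℕ) (b e : Bool) (w : List ℕ) : List ℕ :=
  (if b then [i] else []) ++ interleave i e w

section wrap

variable {i : ℕ} {b e : Bool} {w : List ℕ}

theorem mem_wrap {a : ℕ} (h : a ∈ wrap i b e w) : a = i ∨ a ∈ w := by
  rcases List.mem_append.1 h with h | h
  · cases b <;> simp_all
  · exact mem_interleave h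

theorem subset_wrap : w ⊆ wrap i b e w :=
  fun _ ha => List.mem_append_right _ (subset_interleave ha)

theorem alternating_wrap (h : ∀ a ∈ w, i < a) : Alternating i (wrap i b e w) := by
  have := alternating_cons_interleave (e := e) h
  cases b
  · exact this.tail
  · exact this

theorem filter_wrap (h : ∀ a ∈ w, i < a) : (wrap i b e w).filter (· ≠ i) = w := by
  rw [wrap, List.filter_append, filter_interleave h]
  cases b <;> simp

theorem head?_wrap (hw : w ≠ []) (h : ∀ a ∈ w, i < a) :
    (wrap i b e w).head? = some i ↔ b = true := by
  cases b
  · obtain ⟨c, w, rfl⟩ := List.exists_cons_of_ne_nil hw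
    simp [wrap, head?_interleave, (h c (by simp)).ne']
  · simp [wrap]

theorem getLast?_wrap (hw : w ≠ []) (h : ∀ a ∈ w, i < a) :
    (wrap i b e w).getLast? = some i ↔ e = true := by
  rw [← getLast?_interleave hw h, wrap, List.getLast?_append_of_ne_nil]
  intro h0
  have := subset_interleave (i := i) (e := e) (w := w)
  rw [h0] at this
  exact hw (List.subset_nil.1 this)

end wrap

/-- The word with largest letter `i + d` over the letters from `i` on that is obtained by wrapping
with the letters `i + d - 1, …, i`. -/
def buildWord (b e : ℕ → Bool) : ℕ → ℕ → List ℕ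
  | i, 0 => [i]
  | i, d + 1 => wrap i (b i) (e i) (buildWord b e (i + 1) d)

theorem buildWord_spec (b e : ℕ → Bool) (i d : ℕ) :
    (∀ a ∈ buildWord b e i d, i ≤ a ∧ a ≤ i + d) ∧ i + d ∈ buildWord b e i d := by
  induction d generalizing i with
  | zero => simp [buildWord]
  | succ d ih =>
    constructor
    · intro a ha
      rcases mem_wrap ha with rfl | ha
      · omega
      · have := (ih (i + 1)).1 a ha
        omega
    · have := subset_wrap (i := i) (b := b i) (e := e i) (ih (i + 1)).2
      rwa [Nat.add_assoc, Nat.add_comm 1] at this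

theorem buildWord_ne_nil (b e : ℕ → Bool) (i d : ℕ) : buildWord b e i d ≠ [] :=
  List.ne_nil_of_mem (buildWord_spec b e i d).2

theorem alternating_buildWord (b e : ℕ → Bool) (i d : ℕ) :
    Alternating i (buildWord b e i d) := by
  cases d with
  | zero => simp [Alternating, buildWord]
  | succ d => exact alternating_wrap fun a ha => ((buildWord_spec b e (i + 1) d).1 a ha).1

theorem filter_buildWord (b e : ℕ → Bool) (i d : ℕ) :
    (buildWord b e i (d + 1)).filter (· ≠ i) = buildWord b e (i + 1) d :=
  filter_wrap fun a ha => ((buildWord_spec b e (i + 1) d).1 a ha).1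

/-- For `d = 0` the word is the single letter `i`, whatever the flag says; the hypothesis is the
rank condition of `Solves`. -/
theorem head?_buildWord {b e : ℕ → Bool} {i d : ℕ} (h : d = 0 → b i = true) :
    (buildWord b e i d).head? = some i ↔ b i = true := by
  cases d with
  | zero => simp [buildWord, h]
  | succ d =>
    exact head?_wrap (buildWord_ne_nil _ _ _ _)
      fun a ha => ((buildWord_spec b e (i + 1) d).1 a ha).1

theorem getLast?_buildWord {b e : ℕ → Bool} {i d : ℕ} (h : d = 0 → e i = true) :
    (buildWord b e i d).getLast? = some i ↔ e i = true := by
  cases d with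
  | zero => simp [buildWord, h]
  | succ d =>
    exact getLast?_wrap (buildWord_ne_nil _ _ _ _)
      fun a ha => ((buildWord_spec b e (i + 1) d).1 a ha).1

/-! ### Compression of the built words -/

/-- An inserted `i` between two letters of `w` has larger letters on both sides and is deleted; a
final `i` has nothing behind it and stays. The letters of `w` are judged as before, since `i` is
smaller than all of them. Two left contexts are allowed because the passed copies of `i` occur in
only one of them. -/
theorem compressAux_interleave {i : ℕ} {e : Bool} {w : List ℕ} (h : ∀ a ∈ w, i < a)
    {left left' : List ℕ} (hl : ∀ a, i < a → ((∃ c ∈ left, a < c) ↔ ∃ c ∈ left', a < c)) :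
    compressAux left (interleave i e w) =
      compressAux left' w ++ if w ≠ [] ∧ e = true then [i] else [] := by
  induction w generalizing left left' with
  | nil => simp [interleave, compressAux]
  | cons c w ih =>
    have hc : i < c := h c (by simp)
    rcases eq_or_ne w [] with rfl | hw
    · cases e
      · simp [interleave, compressAux]
      · simp [interleave, compressAux, hc.le]
    · obtain ⟨c', hc'⟩ := List.exists_mem_of_ne_nil w hw
      have h' : ∀ a ∈ w, i < a := fun a ha => h a (by simp [ha])
      have hmid : compressAux (c :: left) (i :: interleave i e w) =
          compressAux (i :: c :: left) (interleave i e w) := by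
        rw [compressAux, if_pos]
        exact ⟨⟨c, by simp, hc⟩, c', subset_interleave hc', h' c' hc'⟩
      have hl' : ∀ a, i < a →
          ((∃ d ∈ i :: c :: left, a < d) ↔ ∃ d ∈ c :: left', a < d) := by
        intro a ha
        have := hl a ha
        simp only [List.exists_mem_cons_iff]
        rw [this]
        constructor
        · rintro (h | h | h)
          · omega
          · exact .inl h
          · exact .inr h
        · exact .inr
      have hr : (∃ d ∈ i :: interleave i e w, c < d) ↔ ∃ d ∈ w, c < d := by
        constructor
        · rintro ⟨d, hd, hcd⟩
          rcases List.mem_cons.1 hd with rfl | hd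
          · omega
          · rcases mem_interleave hd with rfl | hd
            · omega
            · exact ⟨d, hd, hcd⟩
        · rintro ⟨d, hd, hcd⟩
          exact ⟨d, List.mem_cons_of_mem _ (subset_interleave hd), hcd⟩
      rw [interleave_cons_ne_nil hw, compressAux, hmid, ih h' hl', compressAux]
      simp only [hl c hc, hr, hw, ne_eq, not_false_eq_true, reduceCtorEq, true_and]
      split_ifs <;> simp

theorem compress_wrap {i : ℕ} {b e : Bool} {w : List ℕ} (hw : w ≠ []) (h : ∀ a ∈ w, i < a) :
    compress (wrap i b e w) =
      (if b then [i] else []) ++ compress w ++ if e then [i] else [] := by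
  cases b
  · simp [compress, wrap, compressAux_interleave h (left' := []), hw]
  · have hl : ∀ a, i < a → ((∃ c ∈ [i], a < c) ↔ ∃ c ∈ ([] : List ℕ), a < c) := by
      intro a ha
      simp [ha.le]
    simp [compress, wrap, compressAux, compressAux_interleave h hl, hw]

/-- Each wrapping changes the compressed word only at its ends, and the smallest letters come
outermost: an ascending part given by `b`, the largest letter, a descending part given by `e`. -/
theorem compress_buildWord (b e : ℕ → Bool) (i d : ℕ) :
    compress (buildWord b e i d) =
      (List.range' i d).filter b ++ [i + d] ++ ((List.range' i d).filter e).reverse := by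
  induction d generalizing i with
  | zero => simp [buildWord, compress, compressAux]
  | succ d ih =>
    rw [buildWord, compress_wrap (buildWord_ne_nil _ _ _ _)
      (fun a ha => ((buildWord_spec b e (i + 1) d).1 a ha).1), ih, List.range'_succ,
      List.filter_cons, List.filter_cons, Nat.add_assoc, Nat.add_comm 1]
    cases b i <;> cases e i <;> simp

/-! ### The solvability of the levels is sufficient -/

/-- The value of a variable of rank `r` that is given by the letters at the ends. -/
def valueWord (b e : ℕ → Bool) (r : ℕ) : List ℕ := buildWord b e 1 (r - 1)

/-- Induction from the highest level down. The constraints of level `i` make the concatenation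
alternating, and without the letter `i` it is the concatenation of the next level, to which the
induction hypothesis applies. -/
theorem isInfix_ziminFrom {α : Type*} {pat : List α} {R : α → ℕ} {b e : ℕ → α → Bool} {i d : ℕ}
    (hR : ∀ x ∈ pat, R x < i + d) (hs : ∀ j, i ≤ j → j < i + d → Solves pat R j (b j) (e j)) :
    (pat.filter (i ≤ R ·)).flatMap (fun x => buildWord (b · x) (e · x) i (R x - i)) <:+:
      ziminFrom i d := by
  induction d generalizing i with
  | zero =>
    rw [List.filter_eq_nil_iff.2 fun x hx => by simpa using hR x hx]
    simp [ziminFrom]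
  | succ d ih =>
    rw [ziminFrom_succ]
    have hsi := hs i le_rfl (by omega)
    refine Alternating.isInfix ?_ ?_
    · rw [List.flatMap_def, Alternating, List.isChain_flatten]
      · refine ⟨?_, ?_⟩
        · intro w hw
          obtain ⟨x, -, rfl⟩ := List.mem_map.1 hw
          exact alternating_buildWord _ _ _ _
        · refine (List.isChain_map _).2 ?_
          have hmem : ∀ x ∈ pat.filter (i ≤ R ·), x ∈ pat ∧ i ≤ R x := by
            intro x hx
            simpa using hx
          have := hsi.chain
          rw [List.isChain_iff_getElem] at this ⊢
          intro j hj y hy z hz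
          have hj' := this j hj
          obtain ⟨h1, h1'⟩ := hmem _ (List.getElem_mem (show j < _ by omega))
          obtain ⟨h2, h2'⟩ := hmem _ (List.getElem_mem hj)
          generalize (pat.filter (i ≤ R ·))[j] = x₁ at *
          generalize (pat.filter (i ≤ R ·))[j + 1] = x₂ at *
          -- Both variables have rank at least `i`, so a zero difference means rank exactly `i`,
          -- where the flags are forced.
          have e1 := getLast?_buildWord (b := (b · x₁)) (e := (e · x₁)) (i := i) (d := R x₁ - i)
            fun h0 => (hsi.rank _ h1 (by omega)).2
          have e2 := head?_buildWord (b := (b · x₂)) (e := (e · x₂)) (i := i) (d := R x₂ - i)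
            fun h0 => (hsi.rank _ h2 (by omega)).1
          rw [Option.mem_def.1 hy, Option.some.injEq] at e1
          rw [Option.mem_def.1 hz, Option.some.injEq] at e2
          rw [e1, ne_eq, e2]
          cases h3 : e i x₁ <;> cases h4 : b i x₂ <;> simp_all
      · simp only [List.mem_map, not_exists, not_and]
        intro x _
        exact buildWord_ne_nil _ _ _ _
    · have := ih (i := i + 1) (fun x hx => by have := hR x hx; omega)
        fun j hj hj' => hs j (by omega) (by omega)
      convert this using 1
      -- Deleting `i` erases the values of rank `i`, which are `[i]`, and undoes the outermost
      -- wrapping of all others.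
      rw [List.filter_flatMap]
      clear * -
      induction pat with
      | nil => rfl
      | cons x l ih =>
        rcases lt_trichotomy (R x) i with h | h | h
        · rw [List.filter_cons_of_neg (by simpa using h), ih,
            List.filter_cons_of_neg (by simp; omega)]
        · rw [List.filter_cons_of_pos (by simpa using h.ge), List.flatMap_cons, ih,
            List.filter_cons_of_neg (by simp; omega), h, Nat.sub_self]
          simp [buildWord]
        · obtain ⟨c, hc⟩ : ∃ c, R x = i + 1 + c := ⟨R x - (i + 1), by omega⟩
          rw [List.filter_cons_of_pos (by simpa using h.le), List.flatMap_cons, ih,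
            List.filter_cons_of_pos (by simp; omega), List.flatMap_cons, hc,
            show i + 1 + c - i = c + 1 by omega, filter_buildWord, Nat.add_sub_cancel_left]

theorem isRankedOccurrence_valueWord {m k : ℕ} {pat : List (Fin m)} {R : Fin m → ℕ}
    {b e : ℕ → Fin m → Bool} (hR1 : ∀ x, 1 ≤ R x) (hRk : ∀ x, R x ≤ k)
    (hs : ∀ i, 1 ≤ i → i ≤ k → Solves pat R i (b i) (e i)) :
    IsRankedOccurrence pat R k fun x => valueWord (b · x) (e · x) (R x) where
  nonerasing x := buildWord_ne_nil _ _ _ _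
  rank_eq x := by
    have := buildWord_spec (b · x) (e · x) 1 (R x - 1)
    rw [show 1 + (R x - 1) = R x by have := hR1 x; omega] at this
    exact ⟨this.2, fun a ha => (this.1 a ha).2⟩
  factor := by
    have := isInfix_ziminFrom (pat := pat) (R := R) (b := b) (e := e) (i := 1) (d := k)
      (fun x _ => by have := hRk x; omega) fun j h1 h2 => hs j h1 (by omega)
    rwa [List.filter_eq_self.2 fun x _ => by simpa using hR1 x, ziminFrom_one] at this

theorem compress_valueWord (b e : ℕ → Bool) {r : ℕ} (hr : 1 ≤ r) :
    compress (valueWord b e r) =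
      (List.range' 1 (r - 1)).filter b ++ [r] ++ ((List.range' 1 (r - 1)).filter e).reverse := by
  rw [valueWord, compress_buildWord, show 1 + (r - 1) = r by omega]

/-! ### The constraints of one level as a reachability problem

The gaps of a word `l` are numbered `0, …, l.length`, the letter `j` being between the gaps `j` and
`j + 1`. -/

/-- A set of gaps of `l` that contains the gaps behind the variables of rank `i` and that, with a
gap before (behind) one occurrence of a variable, contains the gaps before (behind) all. -/
structure GapClosed (l : List ℕ) (ρ : ℕ → ℕ) (i : ℕ) (S : ℕ → Prop) : Prop where
  seed : ∀ j < l.length, ρ (l.getD j 0) = i → S (j + 1)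
  before : ∀ j < l.length, ∀ j' < l.length, l.getD j 0 = l.getD j' 0 → S j → S j'
  behind : ∀ j < l.length, ∀ j' < l.length, l.getD j 0 = l.getD j' 0 → S (j + 1) → S (j' + 1)

/-- The gap `g` is in all closed sets of gaps. -/
def Reached (l : List ℕ) (ρ : ℕ → ℕ) (i g : ℕ) : Prop := ∀ S, GapClosed l ρ i S → S g

/-- The closure conditions are preserved by intersections, so there is a least closed set. -/
theorem gapClosed_reached (l : List ℕ) (ρ : ℕ → ℕ) (i : ℕ) : GapClosed l ρ i (Reached l ρ i) where
  seed j hj h _ hS := hS.seed j hj h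
  before j hj j' hj' h hr S hS := hS.before j hj j' hj' h (hr S hS)
  behind j hj j' hj' h hr S hS := hS.behind j hj j' hj' h (hr S hS)

/-- No gap before a variable of rank `i` is reached. -/
def Consistent (l : List ℕ) (ρ : ℕ → ℕ) (i : ℕ) : Prop :=
  ∀ j < l.length, ρ (l.getD j 0) = i → ¬ Reached l ρ i j

open Classical in
/-- Does the value of the variable `x` begin with `i`? -/
noncomputable def beginsWith (l : List ℕ) (ρ : ℕ → ℕ) (i x : ℕ) : Bool :=
  decide (∃ j < l.length, l.getD j 0 = x ∧ ¬ Reached l ρ i j)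

open Classical in
/-- Does the value of the variable `x` end with `i`? -/
noncomputable def endsWith (l : List ℕ) (ρ : ℕ → ℕ) (i x : ℕ) : Bool :=
  decide (∃ j < l.length, l.getD j 0 = x ∧ Reached l ρ i (j + 1))

/-- By closedness the mark before a variable does not depend on the occurrence, so any single
occurrence decides the flag. -/
theorem beginsWith_getD {l : List ℕ} {ρ : ℕ → ℕ} {i j : ℕ} (hj : j < l.length) :
    beginsWith l ρ i (l.getD j 0) = true ↔ ¬ Reached l ρ i j := by
  simp only [beginsWith, decide_eq_true_eq]
  constructor
  · rintro ⟨j', hj', h, hr⟩ hr'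
    exact hr ((gapClosed_reached l ρ i).before j hj j' hj' h.symm hr')
  · exact fun h => ⟨j, hj, rfl, h⟩

theorem endsWith_getD {l : List ℕ} {ρ : ℕ → ℕ} {i j : ℕ} (hj : j < l.length) :
    endsWith l ρ i (l.getD j 0) = true ↔ Reached l ρ i (j + 1) := by
  simp only [endsWith, decide_eq_true_eq]
  constructor
  · rintro ⟨j', hj', h, hr⟩
    exact (gapClosed_reached l ρ i).behind j' hj' j hj h hr
  · exact fun h => ⟨j, hj, rfl, h⟩

/-- The pattern without the variables of rank less than `i`. -/
def level (pl : List ℕ) (ρ : ℕ → ℕ) (i : ℕ) : List ℕ := pl.filter (i ≤ ρ ·)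

theorem getD_mem {l : List ℕ} {j : ℕ} (hj : j < l.length) : l.getD j 0 ∈ l := by
  rw [List.getD_eq_getElem _ _ hj]
  exact List.getElem_mem hj

theorem mem_level {pl : List ℕ} {ρ : ℕ → ℕ} {i x : ℕ} :
    x ∈ level pl ρ i ↔ x ∈ pl ∧ i ≤ ρ x := by
  simp [level]

theorem length_level_le (pl : List ℕ) (ρ : ℕ → ℕ) (i : ℕ) : (level pl ρ i).length ≤ pl.length :=
  List.length_filter_le _ _

theorem exists_getD_eq {l : List ℕ} {x : ℕ} (hx : x ∈ l) : ∃ j < l.length, l.getD j 0 = x := by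
  obtain ⟨j, hj, rfl⟩ := List.getElem_of_mem hx
  exact ⟨j, hj, List.getD_eq_getElem _ _ hj⟩

/-- At each inner gap, the variable on the left ends with `i` if the gap is reached, and the one on
the right begins with `i` if it is not: exactly one of the two. -/
theorem Consistent.solves {pl : List ℕ} {ρ : ℕ → ℕ} {i : ℕ}
    (h : Consistent (level pl ρ i) ρ i) :
    Solves pl ρ i (beginsWith (level pl ρ i) ρ i) (endsWith (level pl ρ i) ρ i) where
  chain := by
    change List.IsChain _ (level pl ρ i)
    rw [List.isChain_iff_getElem]
    intro j hj
    have h1 := endsWith_getD (ρ := ρ) (i := i) (show j < (level pl ρ i).length by omega)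
    have h2 := beginsWith_getD (ρ := ρ) (i := i) hj
    rw [List.getD_eq_getElem _ _ (by omega)] at h1
    rw [List.getD_eq_getElem _ _ hj] at h2
    intro h3
    rw [h3, h2] at h1
    tauto
  rank x hx hxi := by
    obtain ⟨j, hj, rfl⟩ := exists_getD_eq (mem_level.2 ⟨hx, hxi.ge⟩)
    exact ⟨(beginsWith_getD hj).2 (h j hj hxi),
      (endsWith_getD hj).2 ((gapClosed_reached _ _ _).seed j hj hxi)⟩

/-- Any solution defines a closed set of gaps that avoids those before variables of rank `i`; the
least closed set is contained in it. -/
theorem Solves.consistent {pl : List ℕ} {ρ : ℕ → ℕ} {i : ℕ} {b e : ℕ → Bool}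
    (h : Solves pl ρ i b e) : Consistent (level pl ρ i) ρ i := by
  set l := level pl ρ i with hl
  -- Gap `0` has no variable on its left, so there membership is read off the variable on its right.
  let S : ℕ → Prop := fun g => if g = 0 then b (l.getD 0 0) = false else e (l.getD (g - 1) 0) = true
  have hS : ∀ j < l.length, (S j ↔ b (l.getD j 0) = false) := by
    intro j hj
    rcases j with _ | j
    · simp [S]
    · have h0 : l.IsChain fun x y => e x ≠ b y := h.chain
      have h1 := List.isChain_iff_getElem.1 h0 j hj
      rw [← List.getD_eq_getElem l 0, ← List.getD_eq_getElem l 0] at h1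
      simp only [S, Nat.add_eq_zero_iff, one_ne_zero, and_false, if_false, Nat.add_sub_cancel]
      cases h3 : b (l.getD (j + 1) 0) <;> simp_all
  have hmem : ∀ j < l.length, l.getD j 0 ∈ pl := fun j hj => (mem_level.1 (getD_mem hj)).1
  have hc : GapClosed l ρ i S := by
    refine ⟨fun j hj hr => (h.rank _ (hmem j hj) hr).2, fun j hj j' hj' hw => ?_,
      fun j hj j' hj' hw => ?_⟩
    · rw [hS j hj, hS j' hj', hw]
      exact id
    · simp only [S, Nat.add_eq_zero_iff, one_ne_zero, and_false, if_false, Nat.add_sub_cancel, hw]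
      exact id
  intro j hj hr hreach
  have h1 := (hS j hj).1 (hreach S hc)
  rw [(h.rank _ (hmem j hj) hr).1] at h1
  exact absurd h1 (by simp)

theorem solves_map {α β : Type*} {pat : List α} {f : α → β} {R : β → ℕ} {i : ℕ}
    {b e : β → Bool} :
    Solves (pat.map f) R i b e ↔ Solves pat (R ∘ f) i (b ∘ f) (e ∘ f) := by
  constructor
  · rintro ⟨h1, h2⟩
    rw [List.filter_map, List.isChain_map] at h1
    exact ⟨h1, fun x hx => h2 (f x) (List.mem_map_of_mem hx)⟩
  · rintro ⟨h1, h2⟩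
    refine ⟨?_, ?_⟩
    · rw [List.filter_map, List.isChain_map]
      exact h1
    · intro y hy
      obtain ⟨x, hx, rfl⟩ := List.mem_map.1 hy
      exact h2 x hx

/-! ### Cyclic lists of equal letters -/

/-- `A` permutes the positions `0, …, j - 1` such that its orbits are the sets of all positions
with the same letter. -/
structure Cyclic (w : ℕ → ℕ) (j : ℕ) (A : ℕ → ℕ) : Prop where
  lt : ∀ q < j, A q < j
  same : ∀ q < j, w (A q) = w q
  trans : ∀ S : ℕ → Prop, (∀ q < j, S q → S (A q)) →
    ∀ q < j, ∀ q' < j, w q = w q' → S q → S q'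

theorem Cyclic.zero (w A : ℕ → ℕ) : Cyclic w 0 A :=
  ⟨by simp, by simp, by simp⟩

/-- A new letter starts a cycle of length one. -/
theorem Cyclic.insert_new {w A : ℕ → ℕ} {j : ℕ} (h : Cyclic w j A) (hn : ∀ q < j, w q ≠ w j) :
    Cyclic w (j + 1) (Function.update A j j) := by
  have hA : ∀ q < j, Function.update A j j q = A q := fun q hq =>
    Function.update_of_ne hq.ne _ _
  refine ⟨fun q hq => ?_, fun q hq => ?_, fun S hS q hq q' hq' hw hSq => ?_⟩
  · rcases Nat.lt_succ_iff_lt_or_eq.1 hq with hq | rfl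
    · rw [hA q hq]
      exact (h.lt q hq).trans (Nat.lt_succ_self j)
    · simp
  · rcases Nat.lt_succ_iff_lt_or_eq.1 hq with hq | rfl
    · rw [hA q hq, h.same q hq]
    · simp
  · rcases Nat.lt_succ_iff_lt_or_eq.1 hq with hq | rfl
    · rcases Nat.lt_succ_iff_lt_or_eq.1 hq' with hq' | rfl
      · refine h.trans S (fun p hp hSp => ?_) q hq q' hq' hw hSq
        rw [← hA p hp]
        exact hS p (by omega) hSp
      · exact absurd hw (hn q hq)
    · rcases Nat.lt_succ_iff_lt_or_eq.1 hq' with hq' | rfl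
      · exact absurd hw.symm (hn q' hq')
      · exact hSq

/-- The position `j` is spliced into the cycle of its letter, directly behind `p`. -/
theorem Cyclic.insert_old {w A : ℕ → ℕ} {j p : ℕ} (h : Cyclic w j A) (hp : p < j)
    (hw : w p = w j) :
    Cyclic w (j + 1) (Function.update (Function.update A j (A p)) p j) := by
  set A' := Function.update (Function.update A j (A p)) p j with hA'
  have h1 : A' p = j := by simp [A']
  have h2 : A' j = A p := by simp [A', hp.ne']
  have h3 : ∀ q < j, q ≠ p → A' q = A q := fun q hq hqp => by simp [A', hqp, hq.ne]
  refine ⟨fun q hq => ?_, fun q hq => ?_, fun S hS => ?_⟩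
  · rcases eq_or_ne q p with rfl | hqp
    · omega
    · rcases Nat.lt_succ_iff_lt_or_eq.1 hq with hq | rfl
      · rw [h3 q hq hqp]
        exact (h.lt q hq).trans (Nat.lt_succ_self j)
      · rw [h2]
        exact (h.lt p hp).trans (Nat.lt_succ_self q)
  · rcases eq_or_ne q p with rfl | hqp
    · rw [h1, hw]
    · rcases Nat.lt_succ_iff_lt_or_eq.1 hq with hq | rfl
      · rw [h3 q hq hqp, h.same q hq]
      · rw [h2, h.same p hp, hw]
  · have hpj : S p → S j := fun hSp => h1 ▸ hS p (by omega) hSp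
    have hjA : S j → S (A p) := fun hSj => h2 ▸ hS j (by omega) hSj
    -- A set closed under the new successor map is closed under the old one: the old step from `p`
    -- is now the detour through `j`.
    have hold := h.trans S fun q hq hSq => by
      rcases eq_or_ne q p with rfl | hqp
      · exact hjA (hpj hSq)
      · exact h3 q hq hqp ▸ hS q (by omega) hSq
    have hAp : w (A p) = w j := (h.same p hp).trans hw
    intro q hq q' hq' hqq hSq
    rcases Nat.lt_succ_iff_lt_or_eq.1 hq with hq | rfl
    · rcases Nat.lt_succ_iff_lt_or_eq.1 hq' with hq' | rfl
      · exact hold q hq q' hq' hqq hSq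
      · exact hpj (hold q hq p hp (hqq.trans hw.symm) hSq)
    · rcases Nat.lt_succ_iff_lt_or_eq.1 hq' with hq' | rfl
      · exact hold (A p) (h.lt p hp) q' hq' (hAp.trans hqq) (hjA hSq)
      · exact hSq

/-- Following the cycles one step at a time reaches all occurrences, so two successors per gap
replace the quadratic number of closure conditions. -/
theorem Cyclic.gapClosed {l : List ℕ} {ρ A : ℕ → ℕ} {i : ℕ} {S : ℕ → Prop}
    (h : Cyclic (fun j => l.getD j 0) l.length A)
    (hseed : ∀ j < l.length, ρ (l.getD j 0) = i → S (j + 1))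
    (hl : ∀ j < l.length, S j → S (A j)) (hr : ∀ j < l.length, S (j + 1) → S (A j + 1)) :
    GapClosed l ρ i S where
  seed := hseed
  before := h.trans S hl
  behind := h.trans (fun j => S (j + 1)) hr

/-! ### The programs

The registers: `0` length of the pattern, `1` number of variables, `2` the number one, `3` the
highest rank, `4` the level `i`, `5` a position `j`, `6` a variable `x`, `7` a rank, `8` the length
of the reduced pattern, `10` and `11` end and start of the queue, `12` a gap, `13` the answer,
`14` offset of the level in the tables, `15` the number zero; the others are auxiliary.

The arrays: `0` the pattern, `1` the ranks, `2` the output, `3` the reduced pattern, `4` for each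
variable its first occurrence (plus one), `5` the cyclic lists of occurrences, `7` the marks of
the gaps, `8` the queue of the marked gaps, `9` and `10` the tables of the marks before and behind
each variable on each level. -/

/-- The commands of a list, one after the other. -/
def block : List Cmd → Cmd
  | [] => .skip
  | c :: l => .seq c (block l)

theorem wp_block_nil {N : ℕ} {Q : State → ℕ → Prop} {s : State} {b : ℕ} :
    wp N (block []) Q s b ↔ 1 ≤ b ∧ Q s (b - 1) := wp_skip

theorem wp_block_cons {N : ℕ} {c : Cmd} {l : List Cmd} {Q : State → ℕ → Prop} {s : State} {b : ℕ} :
    wp N (block (c :: l)) Q s b ↔ wp N c (wp N (block l) Q) s b := wp_seq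

/-- The array with the contents `f` starts with the list `l`. -/
def Stores (f : ℕ → ℕ) (l : List ℕ) : Prop := ∀ q, ∀ hq : q < l.length, f q = l[q]

theorem Stores.nil (f : ℕ → ℕ) : Stores f [] := by simp [Stores]

theorem Stores.append {f : ℕ → ℕ} {v j : ℕ} {l : List ℕ} (h : Stores f l) (hj : j = l.length) :
    Stores (Function.update f j v) (l ++ [v]) := by
  subst hj
  intro q hq
  rw [List.length_append, List.length_singleton] at hq
  rcases Nat.lt_succ_iff_lt_or_eq.1 hq with hq | rfl
  · rw [List.getElem_append_left hq]
    simp [hq.ne, h q hq]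
  · simp

theorem Stores.getD {f : ℕ → ℕ} {l : List ℕ} (h : Stores f l) {q : ℕ} (hq : q < l.length) :
    f q = l.getD q 0 := by
  rw [h q hq, List.getD_eq_getElem _ _ hq]

/-- The part of the state that the work on a level does not change. -/
structure LevelInput (N : ℕ) (pl : List ℕ) (ρ : ℕ → ℕ) (i : ℕ) (s : State) : Prop where
  len : s.reg 0 = pl.length
  one : s.reg 2 = 1
  lev : s.reg 4 = i
  zero : s.reg 15 = 0
  pat : Stores (s.mem 0) pl
  rank : ∀ x ∈ pl, s.mem 1 x = ρ x
  lt : ∀ x ∈ pl, x < N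
  size : pl.length + 2 ≤ N

theorem LevelInput.of_frame {N : ℕ} {pl : List ℕ} {ρ : ℕ → ℕ} {i : ℕ} {s s' : State} {c : Cmd}
    (h : LevelInput N pl ρ i s) (f : Frame c s s')
    (hr : ∀ x ∈ [0, 2, 4, 15], c.writesReg x = false := by decide)
    (hm : ∀ x ∈ [0, 1], c.writesMem x = false := by decide) : LevelInput N pl ρ i s' where
  len := (f.reg 0 (hr _ (by simp))).trans h.len
  one := (f.reg 2 (hr _ (by simp))).trans h.one
  lev := (f.reg 4 (hr _ (by simp))).trans h.lev
  zero := (f.reg 15 (hr _ (by simp))).trans h.zero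
  pat := by rw [f.mem 0 (hm _ (by simp))]; exact h.pat
  rank := by rw [f.mem 1 (hm _ (by simp))]; exact h.rank
  lt := h.lt
  size := h.size

theorem LevelInput.setReg {N : ℕ} {pl : List ℕ} {ρ : ℕ → ℕ} {i : ℕ} {s : State}
    (h : LevelInput N pl ρ i s) (x v : ℕ) (hx : x ∉ [0, 2, 4, 15] := by decide) :
    LevelInput N pl ρ i (s.setReg x v) := by
  simp only [List.mem_cons, List.not_mem_nil, or_false, not_or] at hx
  refine ⟨?_, ?_, ?_, ?_, h.pat, h.rank, h.lt, h.size⟩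
  · simpa [Ne.symm hx.1] using h.len
  · simpa [Ne.symm hx.2.1] using h.one
  · simpa [Ne.symm hx.2.2.1] using h.lev
  · simpa [Ne.symm hx.2.2.2] using h.zero

/-! ### Reducing the pattern to one level -/

def reduceBody : Cmd := block [.load 6 0 5, .load 7 1 6,
  .ite 7 4 .skip (block [.store 3 8 6, .store 4 6 15, .store 7 8 15, .add 8 8 2]), .add 5 5 2]

/-- Copies the variables of rank at least `i`, and initializes the first occurrences and the
marks. -/
def reduceProg : Cmd := block [.const 5 0, .const 8 0, .loop 5 0 reduceBody, .store 7 8 15]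

theorem level_take_succ (pl : List ℕ) (ρ : ℕ → ℕ) (i : ℕ) {j : ℕ} (hj : j < pl.length) :
    level (pl.take (j + 1)) ρ i =
      level (pl.take j) ρ i ++ if i ≤ ρ pl[j] then [pl[j]] else [] := by
  rw [List.take_succ_eq_append_getElem hj, level, List.filter_append]
  by_cases h : i ≤ ρ pl[j] <;> simp [level, h]

theorem run_reduceProg {N : ℕ} {pl : List ℕ} {ρ : ℕ → ℕ} {i : ℕ} {s : State}
    (h : LevelInput N pl ρ i s) :
    Run N reduceProg s (12 * pl.length + 10) fun s' =>
      s'.reg 8 = (level pl ρ i).length ∧ Stores (s'.mem 3) (level pl ρ i) ∧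
        (∀ x ∈ level pl ρ i, s'.mem 4 x = 0) ∧ ∀ g ≤ (level pl ρ i).length, s'.mem 7 g = 0 := by
  have hsz := h.size
  refine Run.of_wp ?_
  simp only [reduceProg, wp_block_cons, wp_const]
  refine ⟨by omega, by omega, by omega, by omega, ?_⟩
  -- The budget is a rough count: at most `12` steps for each remaining round, test included, and
  -- `5` for what follows. The later loops are budgeted in the same manner.
  refine wp_loop (fun s b => s.reg 5 ≤ pl.length ∧ 12 * (pl.length - s.reg 5) + 5 ≤ b ∧
      s.reg 8 = (level (pl.take (s.reg 5)) ρ i).length ∧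
      Stores (s.mem 3) (level (pl.take (s.reg 5)) ρ i) ∧
      (∀ x ∈ level (pl.take (s.reg 5)) ρ i, s.mem 4 x = 0) ∧
      ∀ g < s.reg 8, s.mem 7 g = 0) ?_ ?_ ?_
  · simp [level, Stores]
  · rintro s' b f ⟨hj, hb, h8, h3, h4, h7⟩ hlt
    have h' := ((h.setReg 5 0).setReg 8 0).of_frame f
    have hlt : s'.reg 5 < pl.length := h'.len ▸ hlt
    have hp := h'.pat _ hlt
    have hmem := List.getElem_mem hlt
    have hr := h'.rank _ hmem
    have hl := h'.lt _ hmem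
    have hle : (level (pl.take (s'.reg 5)) ρ i).length ≤ s'.reg 5 :=
      (length_level_le _ _ _).trans (by simp)
    refine ⟨by omega, ?_⟩
    simp only [reduceBody, wp_block_cons, wp_block_nil, wp_load, wp_ite, wp_skip, wp_store, wp_add]
    simp only [State.setReg_reg, State.setReg_mem, State.setMem_reg, State.setMem_mem,
      Nat.reduceEqDiff, reduceIte, hp, hr, h'.lev, h'.one, h'.zero]
    and_intros <;> try omega
    · intro hi
      rw [level_take_succ _ _ _ hlt, if_neg (by omega), List.append_nil]
      and_intros <;> omega
    · intro hi
      rw [level_take_succ _ _ _ hlt, if_pos hi]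
      and_intros <;> try omega
      · simp [h8]
      · exact h3.append h8
      · intro x hx
        rcases List.mem_append.1 hx with hx | hx
        · simp [Function.update_apply, h4 x hx]
        · simp [List.mem_singleton.1 hx]
      · intro g hg
        rcases Nat.lt_succ_iff_lt_or_eq.1 hg with hg | rfl
        · simp [hg.ne, h7 g hg]
        · simp
  · rintro s' b f ⟨hj, hb, h8, h3, h4, h7⟩ hle
    have h' := ((h.setReg 5 0).setReg 8 0).of_frame f
    have hj : s'.reg 5 = pl.length := le_antisymm hj (h'.len ▸ hle)
    rw [hj, List.take_length] at h8 h3 h4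
    have := length_level_le pl ρ i
    -- A word has one gap more than letters; the store after the loop clears the mark of the last
    -- gap.
    simp only [wp_block_cons, wp_block_nil, wp_store]
    simp only [State.setReg_reg, State.setReg_mem, State.setMem_reg, State.setMem_mem,
      Nat.reduceEqDiff, reduceIte, h'.zero, h8]
    refine ⟨by omega, by omega, by omega, by omega, True.intro, h3, h4, fun g hg => ?_⟩
    · rcases hg.lt_or_eq with hg | rfl
      · simp [hg.ne, h7 g (h8 ▸ hg)]
      · simp

/-! ### The queue of marked gaps -/

/-- The queue `Q` of length `n` holds the marked gaps of `0, …, L`, without repetition. -/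
structure IsQueue (L n : ℕ) (mark Q : ℕ → ℕ) : Prop where
  card : n = ((Finset.range (L + 1)).filter (mark · = 1)).card
  mem : ∀ q < n, Q q ≤ L ∧ mark (Q q) = 1
  all : ∀ g ≤ L, mark g = 1 → ∃ q < n, Q q = g
  bit : ∀ g ≤ L, mark g ≤ 1

/-- Counting the marks bounds both the size of the queue and the number of rounds of the search. -/
theorem IsQueue.le {L n : ℕ} {mark Q : ℕ → ℕ} (h : IsQueue L n mark Q) : n ≤ L + 1 := by
  rw [h.card]
  exact (Finset.card_filter_le _ _).trans (Finset.card_range _).le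

theorem IsQueue.push {L n v : ℕ} {mark Q : ℕ → ℕ} (h : IsQueue L n mark Q) (hv : v ≤ L)
    (hm : mark v ≠ 1) :
    n < L + 1 ∧ IsQueue L (n + 1) (Function.update mark v 1) (Function.update Q n v) := by
  have hc : n + 1 =
      ((Finset.range (L + 1)).filter (Function.update mark v 1 · = 1)).card := by
    rw [h.card, ← Finset.card_insert_of_notMem (a := v) (by simp [hm])]
    congr 1
    ext g
    by_cases hg : g = v
    · subst hg
      simp
      omega
    · simp [hg]
  have hq : IsQueue L (n + 1) (Function.update mark v 1) (Function.update Q n v) := by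
    refine ⟨hc, fun q hq => ?_, fun g hg hgm => ?_, fun g hg => ?_⟩
    · rcases Nat.lt_succ_iff_lt_or_eq.1 hq with hq | rfl
      · obtain ⟨h1, h2⟩ := h.mem q hq
        rw [Function.update_of_ne hq.ne]
        refine ⟨h1, ?_⟩
        rw [Function.update_of_ne, h2]
        rintro rfl
        exact hm h2
      · simpa using hv
    · by_cases hgv : g = v
      · exact ⟨n, by omega, by simp [hgv]⟩
      · rw [Function.update_of_ne hgv] at hgm
        obtain ⟨q, hq, rfl⟩ := h.all g hg hgm
        exact ⟨q, by omega, Function.update_of_ne hq.ne _ _⟩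
    · by_cases hgv : g = v
      · simp [hgv]
      · rw [Function.update_of_ne hgv]
        exact h.bit g hg
  exact ⟨hq.le, hq⟩

/-! ### Building the cyclic lists and the initial queue -/

/-- Array `4` holds a position plus one, so that `0` means that the variable has not occurred yet;
the test distinguishes `Cyclic.insert_old` from `Cyclic.insert_new`. -/
def linkCmd : Cmd := .ite 15 9
    (block [.sub 9 9 2, .load 16 5 9, .store 5 5 16, .store 5 9 5])
    (block [.store 5 5 5, .store 4 6 17])

theorem run_linkCmd {N j x : ℕ} {w : ℕ → ℕ} {s : State} (h2 : s.reg 2 = 1) (h15 : s.reg 15 = 0)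
    (h5 : s.reg 5 = j) (h6 : s.reg 6 = x) (h9 : s.reg 9 = s.mem 4 x) (h17 : s.reg 17 = j + 1)
    (hj : j < N) (hx : x < N) (hw : w j = x) (hcyc : Cyclic w j (s.mem 5))
    (hfirst : (s.mem 4 x = 0 ∧ ∀ q < j, w q ≠ x) ∨ ∃ p < j, s.mem 4 x = p + 1 ∧ w p = x) :
    Run N linkCmd s 6 fun s' => Cyclic w (j + 1) (s'.mem 5) ∧
      (∀ g, j < g → s'.mem 5 g = s.mem 5 g) ∧ (∃ p < j + 1, s'.mem 4 x = p + 1 ∧ w p = x) ∧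
      ∀ y, y ≠ x → s'.mem 4 y = s.mem 4 y := by
  refine Run.of_wp ?_
  simp only [linkCmd, wp_block_cons, wp_block_nil, wp_load, wp_ite, wp_store, wp_sub]
  rcases hfirst with ⟨h4, hn⟩ | ⟨p, hp, h4, hwp⟩
  · simp only [State.setReg_reg, State.setReg_mem, State.setMem_reg, State.setMem_mem,
      Nat.reduceEqDiff, reduceIte, h2, h15, h5, h6, h9, h17, h4]
    refine ⟨by omega, by omega, fun _ => ⟨hj, by omega, hx, by omega, by omega,
      hcyc.insert_new (by simpa [hw] using hn), fun g hg => by simp [hg.ne'],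
      ⟨j, by omega, by simp, hw⟩, fun y hy => by simp [hy]⟩⟩
  · have hpN : p < N := by omega
    simp only [State.setReg_reg, State.setReg_mem, State.setMem_reg, State.setMem_mem,
      Nat.reduceEqDiff, reduceIte, h2, h15, h5, h9, h4, Nat.add_sub_cancel]
    exact ⟨by omega, fun _ => ⟨by omega, hpN, by omega, hj, by omega, hpN, by omega, by omega,
      hcyc.insert_old hp (hwp.trans hw.symm), fun g hg => by simp [hg.ne', (hp.trans hg).ne'],
      ⟨p, by omega, rfl, hwp⟩, fun _ _ => trivial⟩, fun _ => by omega⟩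

/-- On the reduced pattern all ranks are at least `i`, so failing the test `i < rank` means rank
`i`. -/
def seedCmd : Cmd := .ite 4 7 .skip (block [.store 7 17 2, .store 8 10 17, .add 10 10 2])

theorem run_seedCmd {N L v : ℕ} {s : State} (h2 : s.reg 2 = 1) (h17 : s.reg 17 = v)
    (hv : v ≤ L) (hL : L + 1 < N) (hm : s.mem 7 v ≠ 1)
    (hq : IsQueue L (s.reg 10) (s.mem 7) (s.mem 8)) :
    Run N seedCmd s 5 fun s' => IsQueue L (s'.reg 10) (s'.mem 7) (s'.mem 8) ∧
      ∀ g, s'.mem 7 g = 1 ↔ s.mem 7 g = 1 ∨ (g = v ∧ s.reg 7 ≤ s.reg 4) := by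
  obtain ⟨hlt, hq'⟩ := hq.push hv hm
  refine Run.of_wp ?_
  simp only [seedCmd, wp_block_cons, wp_block_nil, wp_ite, wp_store, wp_add, wp_skip]
  simp only [State.setReg_reg, State.setReg_mem, State.setMem_reg, State.setMem_mem,
      Nat.reduceEqDiff, reduceIte, h2, h17]
  refine ⟨by omega, fun h => ⟨by omega, hq, fun g => by omega⟩, fun h =>
    ⟨by omega, by omega, by omega, by omega, by omega, by omega, by omega, hq', fun g => ?_⟩⟩
  by_cases hg : g = v <;> simp [hg, h]

def cycleBody : Cmd := block [.load 6 3 5, .load 9 4 6, .add 17 5 2, linkCmd, .load 7 1 6,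
  seedCmd, .copy 5 17]

/-- Builds the cyclic lists of occurrences, and puts the gaps behind the variables of rank `i` into
the queue. -/
def cycleProg : Cmd := block [.const 5 0, .const 10 0, .store 5 8 8, .loop 5 8 cycleBody]

/-- The part of the state that remains when the reduced pattern `w 0, …, w (L - 1)` is known. -/
structure Reduced (N : ℕ) (ρ : ℕ → ℕ) (i L : ℕ) (w : ℕ → ℕ) (s : State) : Prop where
  len : s.reg 8 = L
  one : s.reg 2 = 1
  lev : s.reg 4 = i
  zero : s.reg 15 = 0
  word : ∀ j < L, s.mem 3 j = w j
  rank : ∀ j < L, s.mem 1 (w j) = ρ (w j)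
  le_rank : ∀ j < L, i ≤ ρ (w j)
  lt : ∀ j < L, w j < N
  size : L + 1 < N

theorem Reduced.of_frame {N : ℕ} {ρ : ℕ → ℕ} {i L : ℕ} {w : ℕ → ℕ} {s s' : State} {c : Cmd}
    (h : Reduced N ρ i L w s) (f : Frame c s s')
    (hr : ∀ x ∈ [2, 4, 8, 15], c.writesReg x = false := by decide)
    (hm : ∀ x ∈ [1, 3], c.writesMem x = false := by decide) : Reduced N ρ i L w s' where
  len := (f.reg 8 (hr _ (by simp))).trans h.len
  one := (f.reg 2 (hr _ (by simp))).trans h.one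
  lev := (f.reg 4 (hr _ (by simp))).trans h.lev
  zero := (f.reg 15 (hr _ (by simp))).trans h.zero
  word := by rw [f.mem 3 (hm _ (by simp))]; exact h.word
  rank := by rw [f.mem 1 (hm _ (by simp))]; exact h.rank
  le_rank := h.le_rank
  lt := h.lt
  size := h.size

theorem Reduced.setReg {N : ℕ} {ρ : ℕ → ℕ} {i L : ℕ} {w : ℕ → ℕ} {s : State}
    (h : Reduced N ρ i L w s) (x v : ℕ) (hx : x ∉ [2, 4, 8, 15] := by decide) :
    Reduced N ρ i L w (s.setReg x v) := by
  simp only [List.mem_cons, List.not_mem_nil, or_false, not_or] at hx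
  refine ⟨?_, ?_, ?_, ?_, h.word, h.rank, h.le_rank, h.lt, h.size⟩
  · simpa [Ne.symm hx.2.2.1] using h.len
  · simpa [Ne.symm hx.1] using h.one
  · simpa [Ne.symm hx.2.1] using h.lev
  · simpa [Ne.symm hx.2.2.2] using h.zero

theorem Reduced.setMem {N : ℕ} {ρ : ℕ → ℕ} {i L : ℕ} {w : ℕ → ℕ} {s : State}
    (h : Reduced N ρ i L w s) (a j v : ℕ) (ha : a ∉ [1, 3] := by decide) :
    Reduced N ρ i L w (s.setMem a j v) := by
  simp only [List.mem_cons, List.not_mem_nil, or_false, not_or] at ha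
  refine ⟨h.len, h.one, h.lev, h.zero, ?_, ?_, h.le_rank, h.lt, h.size⟩
  · simpa [Ne.symm ha.2] using h.word
  · simpa [Ne.symm ha.1] using h.rank

theorem run_cycleProg {N i L : ℕ} {ρ w : ℕ → ℕ} {s : State} (h : Reduced N ρ i L w s)
    (h4 : ∀ j < L, s.mem 4 (w j) = 0) (h7 : ∀ g ≤ L, s.mem 7 g = 0) :
    Run N cycleProg s (24 * L + 10) fun s' => Cyclic w L (s'.mem 5) ∧ s'.mem 5 L = L ∧
      IsQueue L (s'.reg 10) (s'.mem 7) (s'.mem 8) ∧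
      ∀ g ≤ L, s'.mem 7 g = 1 ↔ ∃ q < L, g = q + 1 ∧ ρ (w q) = i := by
  have hsz := h.size
  refine Run.of_wp ?_
  simp only [cycleProg, wp_block_cons, wp_const, wp_store]
  simp only [State.setReg_reg, h.len, Nat.reduceEqDiff, reduceIte]
  refine ⟨by omega, by omega, by omega, by omega, by omega, by omega, ?_⟩
  have h0 := ((h.setReg 5 0).setReg 10 0).setMem 5 L L
  refine wp_loop (fun s b => s.reg 5 ≤ L ∧ 24 * (L - s.reg 5) + 3 ≤ b ∧
      Cyclic w (s.reg 5) (s.mem 5) ∧ s.mem 5 L = L ∧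
      (∀ q < L, (s.mem 4 (w q) = 0 ∧ ∀ q' < s.reg 5, w q' ≠ w q) ∨
        ∃ p < s.reg 5, s.mem 4 (w q) = p + 1 ∧ w p = w q) ∧
      IsQueue L (s.reg 10) (s.mem 7) (s.mem 8) ∧
      ∀ g ≤ L, s.mem 7 g = 1 ↔ ∃ q < s.reg 5, g = q + 1 ∧ ρ (w q) = i) ?_ ?_ ?_
  · simp only [State.setReg_reg, State.setReg_mem, State.setMem_reg, State.setMem_mem,
      Nat.reduceEqDiff, reduceIte]
    refine ⟨by omega, by omega, Cyclic.zero _ _, by simp, fun q hq => .inl ⟨h4 q hq, by simp⟩,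
      ⟨?_, by simp, ?_, ?_⟩, ?_⟩
    · refine (Finset.card_eq_zero.2 (Finset.filter_eq_empty_iff.2 ?_)).symm
      intro g hg
      rw [h7 g (by simpa [Nat.lt_succ_iff] using hg)]
      simp
    · intro g hg hg'
      simp [h7 g hg] at hg'
    · intro g hg
      simp [h7 g hg]
    · intro g hg
      simp [h7 g hg]
  · rintro s' b f ⟨hj, hb, hcyc, hlast, hfirst, hqu, hmark⟩ hlt
    have h' := h0.of_frame f
    clear f h h0 h4 h7
    have hlt : s'.reg 5 < L := h'.len ▸ hlt
    have hw := h'.word _ hlt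
    have hl := h'.lt _ hlt
    have hr := h'.rank _ hlt
    have hile := h'.le_rank _ hlt
    refine ⟨by omega, ?_⟩
    simp only [cycleBody, wp_block_cons, wp_load, wp_add]
    simp only [State.setReg_reg, State.setReg_mem, State.setMem_reg, State.setMem_mem,
      Nat.reduceEqDiff, reduceIte, hw, h'.one]
    refine ⟨by omega, by omega, hl, by omega, by omega, by omega, ?_⟩
    refine Run.wp (run_linkCmd (w := w) (j := s'.reg 5) (x := w (s'.reg 5)) (by simp [h'.one])
      (by simp [h'.zero]) (by simp) (by simp) (by simp) (by simp) (by omega) hl rfl hcyc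
      (hfirst _ hlt)) (by omega) fun s₁ b₁ f₁ hb₁ ⟨c1, c2, c3, c4⟩ => ?_
    have h₁ := (((h'.setReg _ _).setReg _ _).setReg _ _).of_frame f₁
    have r5 := f₁.reg 5 rfl
    have r6 := f₁.reg 6 rfl
    have r10 := f₁.reg 10 rfl
    have r17 := f₁.reg 17 rfl
    have m7 := f₁.mem 7 rfl
    have m8 := f₁.mem 8 rfl
    simp only [State.setReg_reg, State.setReg_mem, State.setMem_reg, State.setMem_mem,
      Nat.reduceEqDiff, reduceIte] at c2 c4 r5 r6 r10 r17 m7 m8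
    rw [wp_block_cons, wp_load, r6, h₁.rank _ hlt, wp_block_cons]
    refine ⟨hl, by omega, ?_⟩
    refine Run.wp (run_seedCmd (L := L) (v := s'.reg 5 + 1) (by simp [h₁.one]) (by simp [r17])
      (by omega) hsz ?_ ?_) (by omega) fun s₂ b₂ f₂ hb₂ ⟨d1, d2⟩ => ?_
    -- The gap behind position `j` is not yet marked, since all marked gaps so far lie behind
    -- earlier positions.
    · rw [State.setReg_mem, m7, Ne, hmark _ (by omega)]
      rintro ⟨q, hq, hq', -⟩
      omega
    · simpa only [State.setReg_reg, State.setReg_mem, State.setMem_reg, State.setMem_mem,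
      Nat.reduceEqDiff, reduceIte, r10, m7, m8] using hqu
    have r5' := f₂.reg 5 rfl
    have r17' := f₂.reg 17 rfl
    have m4' := f₂.mem 4 rfl
    have m5' := f₂.mem 5 rfl
    simp only [State.setReg_reg, State.setReg_mem, State.setMem_reg, State.setMem_mem,
      Nat.reduceEqDiff, reduceIte, r5, r17, h₁.lev, m7] at d2 r5' r17' m4' m5'
    simp only [wp_block_cons, wp_block_nil, wp_copy, State.setReg_reg, State.setReg_mem, State.setMem_reg, State.setMem_mem,
      Nat.reduceEqDiff, reduceIte, r17', m4', m5']
    refine ⟨by omega, by omega, by omega, by omega, c1, ?_, fun q hq => ?_, d1, fun g hg => ?_⟩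
    · rw [c2 L hlt, hlast]
    · by_cases hqx : w q = w (s'.reg 5)
      · right
        rw [hqx]
        exact c3
      · rw [c4 _ hqx]
        rcases hfirst q hq with ⟨e1, e2⟩ | ⟨p, hp, e1, e2⟩
        · refine .inl ⟨e1, fun q' hq' => ?_⟩
          rcases Nat.lt_succ_iff_lt_or_eq.1 hq' with hq' | rfl
          · exact e2 q' hq'
          · exact Ne.symm hqx
        · exact .inr ⟨p, by omega, e1, e2⟩
    · rw [d2, hmark g hg]
      constructor
      · rintro (⟨q, hq, e1, e2⟩ | ⟨e1, e2⟩)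
        · exact ⟨q, by omega, e1, e2⟩
        · exact ⟨s'.reg 5, by omega, e1, by omega⟩
      · rintro ⟨q, hq, e1, e2⟩
        rcases Nat.lt_succ_iff_lt_or_eq.1 hq with hq | rfl
        · exact .inl ⟨q, hq, e1, e2⟩
        · exact .inr ⟨e1, e2.le⟩
  · rintro s' b f ⟨hj, hb, hcyc, hlast, hfirst, hqu, hmark⟩ hle
    have hj : s'.reg 5 = L := le_antisymm hj ((h0.of_frame f).len ▸ hle)
    rw [hj] at hcyc hmark
    rw [wp_block_nil]
    exact ⟨by omega, by omega, hcyc, hlast, hqu, hmark⟩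

/-! ### The search for the reached gaps -/

def visitCmd : Cmd := block [.load 16 7 9,
  .ite 15 16 .skip (block [.store 7 9 2, .store 8 10 9, .add 10 10 2])]

theorem run_visitCmd {N L v : ℕ} {s : State} (h2 : s.reg 2 = 1) (h15 : s.reg 15 = 0)
    (h9 : s.reg 9 = v) (hv : v ≤ L) (hL : L + 1 < N)
    (hq : IsQueue L (s.reg 10) (s.mem 7) (s.mem 8)) :
    Run N visitCmd s 7 fun s' => IsQueue L (s'.reg 10) (s'.mem 7) (s'.mem 8) ∧
      (∀ g, s'.mem 7 g = 1 ↔ s.mem 7 g = 1 ∨ g = v) ∧ s.reg 10 ≤ s'.reg 10 ∧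
      ∀ q < s.reg 10, s'.mem 8 q = s.mem 8 q := by
  have hbit := hq.bit v hv
  refine Run.of_wp ?_
  simp only [visitCmd, wp_block_cons, wp_block_nil, wp_ite, wp_store, wp_add, wp_skip, wp_load]
  simp only [State.setReg_reg, State.setReg_mem, State.setMem_reg, State.setMem_mem,
      Nat.reduceEqDiff, reduceIte, h2, h15, h9]
  refine ⟨by omega, by omega, by omega, fun h => ⟨by omega, by omega, hq, fun g => ?_, le_rfl,
    fun _ _ => trivial⟩, fun h => ?_⟩
  · constructor
    · exact .inl
    · rintro (h' | rfl)
      · exact h'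
      · omega
  · obtain ⟨hlt, hq'⟩ := hq.push hv (by omega)
    refine ⟨by omega, by omega, by omega, by omega, by omega, by omega, by omega, by omega, hq',
      fun g => ?_, by omega, fun q hq => by simp [hq.ne]⟩
    by_cases hg : g = v <;> simp [hg]

/-- The gap `g` lies before the letter `g` and behind the letter `g - 1`, so with the successor map
`A` it leads to `A g` and, unless `g = 0`, to `A (g - 1) + 1`. -/
def searchBody : Cmd := block [.load 12 8 11, .add 11 11 2, .load 9 5 12, visitCmd,
  .ite 15 12 (block [.sub 12 12 2, .load 9 5 12, .add 9 9 2, visitCmd]) .skip]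

/-- Marks all gaps that are reached. -/
def searchProg : Cmd := block [.const 11 0, .loop 11 10 searchBody]

/-- Marked gaps are reached, and the successors of all processed gaps are marked. When the queue is
exhausted, all marked gaps are processed, so the marks form a closed set and contain every reached
gap. Each gap enters the queue at most once, whence linear time. -/
theorem run_searchProg {N i : ℕ} {l : List ℕ} {ρ : ℕ → ℕ} {s : State}
    (h : Reduced N ρ i l.length (fun j => l.getD j 0) s)
    (hcyc : Cyclic (fun j => l.getD j 0) l.length (s.mem 5)) (hlast : s.mem 5 l.length = l.length)
    (hqu : IsQueue l.length (s.reg 10) (s.mem 7) (s.mem 8))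
    (hmark : ∀ g ≤ l.length, s.mem 7 g = 1 ↔
      ∃ q < l.length, g = q + 1 ∧ ρ (l.getD q 0) = i) :
    Run N searchProg s (26 * l.length + 40) fun s' => ∀ g ≤ l.length,
      (s'.mem 7 g = 1 ↔ Reached l ρ i g) ∧ s'.mem 7 g ≤ 1 := by
  have hsz := h.size
  refine Run.of_wp ?_
  simp only [searchProg, wp_block_cons, wp_const]
  refine ⟨by omega, by omega, ?_⟩
  -- The last gap has no letter behind it; the sentinel `A L = L`, with `L` the length of `l`, makes
  -- its first successor itself.
  have hA : ∀ g ≤ l.length, s.mem 5 g ≤ l.length := by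
    intro g hg
    rcases hg.lt_or_eq with hg | rfl
    · exact (hcyc.lt g hg).le
    · exact hlast.le
  refine wp_loop (fun s' b => s'.reg 11 ≤ s'.reg 10 ∧ 26 * (l.length + 1 - s'.reg 11) + 3 ≤ b ∧
      IsQueue l.length (s'.reg 10) (s'.mem 7) (s'.mem 8) ∧
      (∀ j < l.length, ρ (l.getD j 0) = i → s'.mem 7 (j + 1) = 1) ∧
      (∀ g ≤ l.length, s'.mem 7 g = 1 → Reached l ρ i g) ∧
      ∀ q < s'.reg 11, s'.mem 7 (s.mem 5 (s'.mem 8 q)) = 1 ∧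
        (0 < s'.mem 8 q → s'.mem 7 (s.mem 5 (s'.mem 8 q - 1) + 1) = 1)) ?_ ?_ ?_
  · simp only [State.setReg_reg, State.setReg_mem, State.setMem_reg, State.setMem_mem,
      Nat.reduceEqDiff, reduceIte]
    refine ⟨by omega, by omega, hqu, fun j hj hr => (hmark _ (by omega)).2 ⟨j, hj, rfl, hr⟩,
      fun g hg hg1 => ?_, by simp⟩
    obtain ⟨q, hq, rfl, hr⟩ := (hmark g hg).1 hg1
    exact (gapClosed_reached l ρ i).seed q hq hr
  · rintro s' b f ⟨hle, hb, hqu', hseed, hsound, hproc⟩ hlt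
    have h' := (h.setReg 11 0).of_frame f
    have h5 : s'.mem 5 = s.mem 5 := f.mem 5 rfl
    obtain ⟨hQ, hQm⟩ := hqu'.mem _ hlt
    have hlen := hqu'.le
    refine ⟨by omega, ?_⟩
    simp only [searchBody, wp_block_cons, wp_load, wp_add]
    simp only [State.setReg_reg, State.setReg_mem, State.setMem_reg, State.setMem_mem,
      Nat.reduceEqDiff, reduceIte, h'.one, h5]
    refine ⟨by omega, by omega, by omega, by omega, by omega, by omega, ?_⟩
    generalize hg₀ : s'.mem 8 (s'.reg 11) = g₀ at *
    have hreach := hsound g₀ hQ hQm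
    have hAr : Reached l ρ i (s.mem 5 g₀) := by
      rcases hQ.lt_or_eq with hQ' | rfl
      · exact (gapClosed_reached l ρ i).before _ hQ' _ (hcyc.lt _ hQ')
          (hcyc.same _ hQ').symm hreach
      · rwa [hlast]
    refine Run.wp (run_visitCmd (L := l.length) (v := s.mem 5 g₀) (by simp [h'.one])
      (by simp [h'.zero]) (by simp) (hA _ hQ) hsz hqu') (by omega)
      fun s₁ b₁ f₁ hb₁ ⟨c1, c2, c3, c4⟩ => ?_
    have h₁ := (((h'.setReg _ _).setReg _ _).setReg _ _).of_frame f₁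
    have r11 := f₁.reg 11 rfl
    have r12 := f₁.reg 12 rfl
    have m5 := f₁.mem 5 rfl
    simp only [State.setReg_reg, State.setReg_mem, State.setMem_reg, State.setMem_mem,
      Nat.reduceEqDiff, reduceIte, h5] at c2 c3 c4 r11 r12 m5
    have hsound₁ : ∀ g ≤ l.length, s₁.mem 7 g = 1 → Reached l ρ i g := by
      intro g hg hg1
      rcases (c2 g).1 hg1 with hg1 | rfl
      · exact hsound g hg hg1
      · exact hAr
    have hseed₁ : ∀ j < l.length, ρ (l.getD j 0) = i → s₁.mem 7 (j + 1) = 1 :=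
      fun j hj hr => (c2 _).2 (.inl (hseed j hj hr))
    have hproc₁ : ∀ q < s'.reg 11, s₁.mem 7 (s.mem 5 (s₁.mem 8 q)) = 1 ∧
        (0 < s₁.mem 8 q → s₁.mem 7 (s.mem 5 (s₁.mem 8 q - 1) + 1) = 1) := by
      intro q hq
      rw [c4 q (by omega)]
      exact ⟨(c2 _).2 (.inl (hproc q hq).1), fun h0 => (c2 _).2 (.inl ((hproc q hq).2 h0))⟩
    have hQ₁ : s₁.mem 8 (s'.reg 11) = g₀ := by rw [c4 _ hlt, hg₀]
    have hA₁ : s₁.mem 7 (s.mem 5 g₀) = 1 := (c2 _).2 (.inr rfl)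
    simp only [wp_block_cons, wp_block_nil, wp_ite, wp_sub, wp_load, wp_add, wp_skip]
    simp only [State.setReg_reg, State.setReg_mem, State.setMem_reg, State.setMem_mem,
      Nat.reduceEqDiff, reduceIte, r12, h₁.zero, h₁.one, m5]
    refine ⟨by omega, fun hpos => ⟨by omega, by omega, by omega, ?_, by omega, ?_⟩,
      fun hz => ⟨by omega, by omega, ?_⟩⟩
    · have := hA (g₀ - 1) (by omega)
      omega
    · have hlt₁ : g₀ - 1 < l.length := by omega
      have hA1 := hcyc.lt _ hlt₁
      have hBr : Reached l ρ i (s.mem 5 (g₀ - 1) + 1) := by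
        refine (gapClosed_reached l ρ i).behind _ hlt₁ _ hA1 (hcyc.same _ hlt₁).symm ?_
        rwa [Nat.sub_add_cancel hpos]
      refine Run.wp (run_visitCmd (L := l.length) (v := s.mem 5 (g₀ - 1) + 1) (by simp [h₁.one])
        (by simp [h₁.zero]) (by simp) (by omega) hsz c1) (by omega)
        fun s₂ b₂ f₂ hb₂ ⟨d1, d2, d3, d4⟩ => ?_
      have r11' := f₂.reg 11 rfl
      simp only [State.setReg_reg, State.setReg_mem, State.setMem_reg, State.setMem_mem,
      Nat.reduceEqDiff, reduceIte, r11] at d2 d3 d4 r11'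
      simp only [wp_block_nil, r11']
      refine ⟨by omega, by omega, by omega, by omega, d1,
        fun j hj hr => (d2 _).2 (.inl (hseed₁ j hj hr)), fun g hg hg1 => ?_, fun q hq => ?_⟩
      · rcases (d2 g).1 hg1 with hg1 | rfl
        · exact hsound₁ g hg hg1
        · exact hBr
      · rw [d4 q (by omega)]
        rcases Nat.lt_succ_iff_lt_or_eq.1 hq with hq | rfl
        · exact ⟨(d2 _).2 (.inl (hproc₁ q hq).1), fun h0 => (d2 _).2 (.inl ((hproc₁ q hq).2 h0))⟩
        · rw [hQ₁]
          exact ⟨(d2 _).2 (.inl hA₁), fun _ => (d2 _).2 (.inr rfl)⟩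
    · rw [r11]
      refine ⟨by omega, by omega, c1, hseed₁, hsound₁, fun q hq => ?_⟩
      rcases Nat.lt_succ_iff_lt_or_eq.1 hq with hq | rfl
      · exact hproc₁ q hq
      · rw [hQ₁]
        exact ⟨hA₁, fun h0 => by omega⟩
  · rintro s' b f ⟨hle, hb, hqu', hseed, hsound, hproc⟩ hge
    rw [wp_block_nil]
    refine ⟨by omega, by omega, fun g hg => ⟨⟨hsound g hg, fun hr => ?_⟩, hqu'.bit g hg⟩⟩
    -- Minimality of the reached set is applied to the set of marks, which is closed at the exit.
    refine hr (fun g => s'.mem 7 g = 1) (hcyc.gapClosed hseed ?_ ?_)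
    · intro j hj hj1
      obtain ⟨q, hq, hqj⟩ := hqu'.all j hj.le hj1
      have := (hproc q (by omega)).1
      rwa [hqj] at this
    · intro j hj hj1
      obtain ⟨q, hq, hqj⟩ := hqu'.all (j + 1) hj hj1
      have := (hproc q (by omega)).2
      rw [hqj] at this
      exact this (by omega)

/-! ### Checking a level, and the loop over all levels -/

def checkBody : Cmd := block [.load 6 3 5, .load 7 1 6,
  .ite 4 7 .skip (block [.load 16 7 5, .ite 15 16 (.const 13 0) .skip]), .add 5 5 2]

/-- Sets the answer to zero if a gap before a variable of rank `i` is marked. -/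
def checkProg : Cmd := block [.const 5 0, .loop 5 8 checkBody]

theorem run_checkProg {N i L : ℕ} {ρ w : ℕ → ℕ} {s : State} (h : Reduced N ρ i L w s)
    (h13 : s.reg 13 ≤ 1) :
    Run N checkProg s (12 * L + 10) fun s' => s'.reg 13 ≤ 1 ∧
      (s'.reg 13 = 1 ↔ s.reg 13 = 1 ∧ ∀ j < L, ρ (w j) = i → s.mem 7 j = 0) := by
  have hsz := h.size
  refine Run.of_wp ?_
  simp only [checkProg, wp_block_cons, wp_const]
  refine ⟨by omega, by omega, ?_⟩
  refine wp_loop (fun s' b => s'.reg 5 ≤ L ∧ 12 * (L - s'.reg 5) + 3 ≤ b ∧ s'.reg 13 ≤ 1 ∧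
      (s'.reg 13 = 1 ↔ s.reg 13 = 1 ∧ ∀ j < s'.reg 5, ρ (w j) = i → s.mem 7 j = 0)) ?_ ?_ ?_
  · simp only [State.setReg_reg, State.setReg_mem, State.setMem_reg, State.setMem_mem,
      Nat.reduceEqDiff, reduceIte]
    exact ⟨by omega, by omega, h13, by simp⟩
  · rintro s' b f ⟨hj, hb, hbit, hok⟩ hlt
    have h' := (h.setReg 5 0).of_frame f
    have h7 : s'.mem 7 = s.mem 7 := f.mem 7 rfl
    have hlt : s'.reg 5 < L := h'.len ▸ hlt
    have hl := h'.lt _ hlt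
    have hile := h'.le_rank _ hlt
    have hsucc : (∀ j < s'.reg 5 + 1, ρ (w j) = i → s.mem 7 j = 0) ↔
        (∀ j < s'.reg 5, ρ (w j) = i → s.mem 7 j = 0) ∧
          (ρ (w (s'.reg 5)) = i → s.mem 7 (s'.reg 5) = 0) := by
      simp only [Nat.lt_succ_iff_lt_or_eq, or_imp, forall_and, forall_eq]
    refine ⟨by omega, ?_⟩
    simp only [checkBody, wp_block_cons, wp_block_nil, wp_ite, wp_load, wp_add, wp_skip, wp_const]
    simp only [State.setReg_reg, State.setReg_mem, State.setMem_reg, State.setMem_mem,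
      Nat.reduceEqDiff, reduceIte, h'.one, h'.zero, h'.lev, h7, h'.word _ hlt, h'.rank _ hlt, hsucc]
    refine ⟨by omega, by omega, hl, by omega, by omega, fun hi => ⟨by omega, by omega, by omega,
      by omega, by omega, by omega, hbit, ?_⟩, fun hi => ⟨by omega, by omega, by omega,
      fun hm => ⟨by omega, by omega, by omega, by omega, by omega, by omega, by omega, by omega,
        by omega, ?_⟩,
      fun hm => ⟨by omega, by omega, by omega, by omega, by omega, by omega, by omega, hbit, ?_⟩⟩⟩
    · rw [hok]
      have : ρ (w (s'.reg 5)) ≠ i := by omega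
      tauto
    · have h1 : ρ (w (s'.reg 5)) = i := by omega
      have h2 : s.mem 7 (s'.reg 5) ≠ 0 := by omega
      simp [h1, h2]
    · rw [hok]
      have h2 : s.mem 7 (s'.reg 5) = 0 := by omega
      tauto
  · rintro s' b f ⟨hj, hb, hbit, hok⟩ hle
    have hj : s'.reg 5 = L := le_antisymm hj (((h.setReg 5 0).of_frame f).len ▸ hle)
    rw [hj] at hok
    rw [wp_block_nil]
    exact ⟨by omega, by omega, hbit, hok⟩

/-- Solves the constraints of one level. -/
def levelProg : Cmd := block [reduceProg, cycleProg, searchProg, checkProg]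

theorem run_levelProg {N : ℕ} {pl : List ℕ} {ρ : ℕ → ℕ} {i : ℕ} {s : State}
    (h : LevelInput N pl ρ i s) (h13 : s.reg 13 ≤ 1) :
    Run N levelProg s (74 * pl.length + 71) fun s' =>
      LevelInput N pl ρ i s' ∧
      Reduced N ρ i (level pl ρ i).length (fun j => (level pl ρ i).getD j 0) s' ∧
      (∀ g ≤ (level pl ρ i).length, (s'.mem 7 g = 1 ↔ Reached (level pl ρ i) ρ i g) ∧
        s'.mem 7 g ≤ 1) ∧
      s'.reg 13 ≤ 1 ∧ (s'.reg 13 = 1 ↔ s.reg 13 = 1 ∧ Consistent (level pl ρ i) ρ i) := by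
  have hlen := length_level_le pl ρ i
  have hsz := h.size
  refine Run.of_wp ?_
  simp only [levelProg, wp_block_cons]
  refine (run_reduceProg h).wp (by omega) fun s₁ b₁ f₁ hb₁ ⟨h8, h3, h4, h7⟩ => ?_
  have i₁ := h.of_frame f₁
  have hmem : ∀ j < (level pl ρ i).length, (level pl ρ i).getD j 0 ∈ pl ∧
      i ≤ ρ ((level pl ρ i).getD j 0) := fun j hj => mem_level.1 (getD_mem hj)
  have r₁ : Reduced N ρ i (level pl ρ i).length (fun j => (level pl ρ i).getD j 0) s₁ :=
    ⟨h8, i₁.one, i₁.lev, i₁.zero, fun j hj => h3.getD hj, fun j hj => i₁.rank _ (hmem j hj).1,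
      fun j hj => (hmem j hj).2, fun j hj => i₁.lt _ (hmem j hj).1, by omega⟩
  have hcycle := run_cycleProg r₁ (fun j hj => h4 _ (getD_mem hj)) h7
  rw [wp_block_cons]
  refine hcycle.wp (by omega) fun s₂ b₂ f₂ hb₂ ⟨c1, c2, c3, c4⟩ => ?_
  have r₂ := r₁.of_frame f₂
  rw [wp_block_cons]
  refine (run_searchProg r₂ c1 c2 c3 c4).wp (by omega) fun s₃ b₃ f₃ hb₃ hm => ?_
  have r₃ := r₂.of_frame f₃
  have e13 : s₃.reg 13 = s.reg 13 :=
    (f₃.reg 13 rfl).trans ((f₂.reg 13 rfl).trans (f₁.reg 13 rfl))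
  rw [wp_block_cons]
  refine (run_checkProg r₃ (e13 ▸ h13)).wp (by omega) fun s₄ b₄ f₄ hb₄ ⟨d1, d2⟩ => ?_
  have m7 : s₄.mem 7 = s₃.mem 7 := f₄.mem 7 rfl
  rw [wp_block_nil]
  refine ⟨by omega, ((i₁.of_frame f₂).of_frame f₃).of_frame f₄, r₃.of_frame f₄, m7 ▸ hm, d1, ?_⟩
  rw [d2, e13]
  refine and_congr_right fun _ => ?_
  have : ∀ j < (level pl ρ i).length, (s₃.mem 7 j = 0 ↔ ¬ Reached (level pl ρ i) ρ i j) := by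
    intro j hj
    obtain ⟨e1, e2⟩ := hm j hj.le
    rw [← e1]
    omega
  exact forall_congr' fun j => forall_congr' fun hj => by rw [this j hj]

/-- Puts the highest rank into the register `3`. -/
def maxProg : Cmd := block [.const 6 0, .const 3 0,
  .loop 6 1 (block [.load 7 1 6, .ite 3 7 (.copy 3 7) .skip, .add 6 6 2])]

theorem run_maxProg {N m k : ℕ} {ρ : ℕ → ℕ} {s : State} (h1 : s.reg 1 = m) (h2 : s.reg 2 = 1)
    (hρ : ∀ x < m, s.mem 1 x = ρ x) (hm : m < N) (hk : ∀ x < m, ρ x ≤ k)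
    (hk' : ∃ x < m, ρ x = k) :
    Run N maxProg s (8 * m + 10) fun s' => s'.reg 3 = k := by
  refine Run.of_wp ?_
  simp only [maxProg, wp_block_cons, wp_const]
  refine ⟨by omega, by omega, by omega, by omega, ?_⟩
  refine wp_loop (fun s' b => s'.reg 6 ≤ m ∧ 8 * (m - s'.reg 6) + 3 ≤ b ∧
      (∀ x < s'.reg 6, ρ x ≤ s'.reg 3) ∧ s'.reg 3 ≤ k) ?_ ?_ ?_
  · simp only [State.setReg_reg, State.setReg_mem, State.setMem_reg, State.setMem_mem,
      Nat.reduceEqDiff, reduceIte]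
    exact ⟨by omega, by omega, by simp, by omega⟩
  · rintro s' b f ⟨hx, hb, hle, hsk⟩ hlt
    have e1 : s'.reg 1 = m := (f.reg 1 rfl).trans h1
    have e2 : s'.reg 2 = 1 := (f.reg 2 rfl).trans h2
    have em : s'.mem 1 = s.mem 1 := f.mem 1 rfl
    have hlt : s'.reg 6 < m := e1 ▸ hlt
    have hkx := hk _ hlt
    refine ⟨by omega, ?_⟩
    simp only [wp_block_cons, wp_block_nil, wp_load, wp_ite, wp_copy, wp_skip, wp_add]
    simp only [State.setReg_reg, State.setReg_mem, State.setMem_reg, State.setMem_mem,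
      Nat.reduceEqDiff, reduceIte, e2, em, hρ _ hlt]
    refine ⟨by omega, by omega, by omega, fun h => ⟨by omega, by omega, by omega, by omega,
      by omega, by omega, fun x hx => ?_, hkx⟩, fun h => ⟨by omega, by omega, by omega, by omega,
      by omega, by omega, fun x hx => ?_, hsk⟩⟩
    · rcases Nat.lt_succ_iff_lt_or_eq.1 hx with hx | rfl
      · exact (hle x hx).trans h.le
      · exact le_rfl
    · rcases Nat.lt_succ_iff_lt_or_eq.1 hx with hx | rfl
      · exact hle x hx
      · exact h
  · rintro s' b f ⟨hx, hb, hle, hsk⟩ hge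
    have e1 : s'.reg 1 = m := (f.reg 1 rfl).trans h1
    obtain ⟨x, hxm, rfl⟩ := hk'
    rw [wp_block_nil]
    exact ⟨by omega, by omega, le_antisymm hsk (hle x (by omega))⟩

/-- Work on the levels `1, …, k`, where `ext` uses the marks of each level. -/
def levelsProg (ext : Cmd) : Cmd := .loop 4 18 (block [levelProg, ext, .add 4 4 2])

/-- One loop serves both problems: `ext` is `skip` for the decision and `recordProg` for the
construction. The property `T` that `ext` maintains may depend only on registers and arrays that
`levelProg` leaves alone. -/
theorem run_levelsProg {N k τ : ℕ} {pl : List ℕ} {ρ : ℕ → ℕ} {ext : Cmd} {s : State}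
    {T : ℕ → State → Prop} (h : LevelInput N pl ρ 1 s) (h13 : s.reg 13 = 1)
    (h18 : s.reg 18 = k + 1) (hk : k + 1 ≤ N) (hT : T 1 s)
    (hTframe : ∀ i s s', s'.reg 1 = s.reg 1 → s'.reg 14 = s.reg 14 → s'.mem 9 = s.mem 9 →
      s'.mem 10 = s.mem 10 → T i s → T i s')
    (hr : ∀ x ∈ [0, 2, 4, 13, 15, 18], ext.writesReg x = false)
    (hm : ∀ x ∈ [0, 1], ext.writesMem x = false)
    (hext : ∀ i s, 1 ≤ i → i ≤ k → T i s →
      Reduced N ρ i (level pl ρ i).length (fun j => (level pl ρ i).getD j 0) s →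
      (∀ g ≤ (level pl ρ i).length, (s.mem 7 g = 1 ↔ Reached (level pl ρ i) ρ i g) ∧
        s.mem 7 g ≤ 1) → Run N ext s τ (T (i + 1))) :
    Run N (levelsProg ext) s (k * (74 * pl.length + τ + 74) + 1) fun s' =>
      (s'.reg 13 = 1 ↔ ∀ i, 1 ≤ i → i ≤ k → Consistent (level pl ρ i) ρ i) ∧ s'.reg 13 ≤ 1 ∧
        T (k + 1) s' := by
  refine Run.of_wp ?_
  -- Here `i` counts the finished levels and `d` those still to come.
  refine wp_loop (fun s' b => s'.reg 18 = k + 1 ∧ ∃ i d, i + 1 + d = k + 1 ∧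
      LevelInput N pl ρ (i + 1) s' ∧ d * (74 * pl.length + τ + 74) + 1 ≤ b ∧ s'.reg 13 ≤ 1 ∧
      (s'.reg 13 = 1 ↔ ∀ i', 1 ≤ i' → i' ≤ i → Consistent (level pl ρ i') ρ i') ∧
      T (i + 1) s') ?_ ?_ ?_
  · exact ⟨h18, 0, k, by omega, h, le_rfl, h13.le,
      by simp only [h13, true_iff]; intro i h1 h2; omega, hT⟩
  · rintro s' b f ⟨e18, i, d, hid, hin, hb, hbit, hok, hTi⟩ hlt
    rw [e18, hin.lev] at hlt
    obtain ⟨d, rfl⟩ : ∃ d', d = d' + 1 := ⟨d - 1, by omega⟩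
    rw [Nat.succ_mul] at hb
    refine ⟨by omega, ?_⟩
    rw [wp_block_cons]
    refine (run_levelProg hin hbit).wp (by omega) fun s₁ b₁ f₁ hb₁ ⟨i₁, r₁, hmark, hbit₁, hok₁⟩ => ?_
    have T₁ := hTframe _ _ _ (f₁.reg 1 rfl) (f₁.reg 14 rfl) (f₁.mem 9 rfl) (f₁.mem 10 rfl) hTi
    rw [wp_block_cons]
    refine (hext _ s₁ (by omega) (by omega) T₁ r₁ hmark).wp (by omega) fun s₂ b₂ f₂ hb₂ T₂ => ?_
    have i₂ := i₁.of_frame f₂ (fun x hx => hr x (by simp at hx ⊢; tauto)) hm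
    have e13 : s₂.reg 13 = s₁.reg 13 := f₂.reg 13 (hr _ (by simp))
    have e18₂ : s₂.reg 18 = k + 1 :=
      (f₂.reg 18 (hr _ (by simp))).trans ((f₁.reg 18 rfl).trans e18)
    simp only [wp_block_cons, wp_block_nil, wp_add, i₂.lev, i₂.one]
    refine ⟨by omega, by omega, by omega, by simpa using e18₂, i + 1, d, by omega, ?_, ?_, ?_, ?_, ?_⟩
    · exact ⟨i₂.len, i₂.one, rfl, i₂.zero, i₂.pat, i₂.rank, i₂.lt, i₂.size⟩
    · omega
    · simpa only [State.setReg_reg, State.setReg_mem, State.setMem_reg, State.setMem_mem,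
      Nat.reduceEqDiff, reduceIte, e13] using hbit₁
    · simp only [State.setReg_reg, State.setReg_mem, State.setMem_reg, State.setMem_mem,
      Nat.reduceEqDiff, reduceIte, e13, hok₁, hok]
      constructor
      · rintro ⟨g1, g2⟩ i' h1 h2
        rcases Nat.le_succ_iff.1 h2 with h2 | rfl
        · exact g1 i' h1 h2
        · exact g2
      · intro g
        exact ⟨fun i' h1 h2 => g i' h1 (by omega), g (i + 1) (by omega) le_rfl⟩
    · exact hTframe _ s₂ _ (by simp) (by simp) (by simp) (by simp) T₂
  · rintro s' b f ⟨e18, i, d, hid, hin, hb, hbit, hok, hTi⟩ hge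
    rw [e18, hin.lev] at hge
    obtain rfl : i = k := by omega
    exact ⟨by omega, hok, hbit, hTi⟩

/-! ### Recording the marks of all levels -/

/-- The tables hold the marks of the levels below `i`, for `m` variables. -/
structure Tables (pl : List ℕ) (ρ : ℕ → ℕ) (m i : ℕ) (s : State) : Prop where
  vars : s.reg 1 = m
  offset : s.reg 14 + m = i * m
  before : ∀ t, t + 1 < i → ∀ x ∈ level pl ρ (t + 1),
    (s.mem 9 (t * m + x) = 0 ↔ beginsWith (level pl ρ (t + 1)) ρ (t + 1) x = true)
  behind : ∀ t, t + 1 < i → ∀ x ∈ level pl ρ (t + 1),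
    (0 < s.mem 10 (t * m + x) ↔ endsWith (level pl ρ (t + 1)) ρ (t + 1) x = true)

/-- Copies the marks of a level to the tables. -/
def recordProg : Cmd := block [.const 5 0, .loop 5 8 (block [.load 6 3 5, .add 9 14 6,
  .load 16 7 5, .store 9 9 16, .add 5 5 2, .load 16 7 5, .store 10 9 16]), .add 14 14 1]

/-- Each level fills one row of length `m`. The flags have opposite polarity: a variable begins with
the letter if the gap before it is unmarked, and ends with it if the gap behind it is marked. -/
theorem run_recordProg {N m i k : ℕ} {pl : List ℕ} {ρ : ℕ → ℕ} {s : State}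
    (hi : 1 ≤ i) (hik : i ≤ k) (hT : Tables pl ρ m i s)
    (h : Reduced N ρ i (level pl ρ i).length (fun j => (level pl ρ i).getD j 0) s)
    (hmark : ∀ g ≤ (level pl ρ i).length, (s.mem 7 g = 1 ↔ Reached (level pl ρ i) ρ i g) ∧
        s.mem 7 g ≤ 1) (hm : ∀ x ∈ pl, x < m) (hN : m * k < N) :
    Run N recordProg s (9 * pl.length + 6) (Tables pl ρ m (i + 1)) := by
  have hlen := length_level_le pl ρ i
  obtain ⟨h1, h14, hb, he⟩ := hT
  have hsz := h.size
  obtain ⟨i, rfl⟩ : ∃ i', i = i' + 1 := ⟨i - 1, by omega⟩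
  rw [Nat.succ_mul, Nat.add_right_cancel_iff] at h14
  have hNi : i * m + m < N := by
    refine lt_of_le_of_lt ?_ hN
    rw [← Nat.succ_mul, Nat.mul_comm]
    exact Nat.mul_le_mul_left m hik
  have hmem : ∀ x ∈ level pl ρ (i + 1), x < m := fun x hx => hm x (mem_level.1 hx).1
  -- Writing the current row does not touch the earlier ones.
  have hbelow : ∀ t x y, t < i → x < m → t * m + x ≠ i * m + y := by
    intro t x y ht hx
    have := Nat.mul_le_mul_right m (show t + 1 ≤ i from ht)
    rw [Nat.succ_mul] at this
    omega
  refine Run.of_wp ?_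
  simp only [recordProg, wp_block_cons, wp_const]
  refine ⟨by omega, by omega, ?_⟩
  generalize hl : level pl ρ (i + 1) = l at *
  refine wp_loop (fun s' b => s'.reg 5 ≤ l.length ∧ 9 * (l.length - s'.reg 5) + 4 ≤ b ∧
      (∀ t < i, ∀ x < m, s'.mem 9 (t * m + x) = s.mem 9 (t * m + x) ∧
        s'.mem 10 (t * m + x) = s.mem 10 (t * m + x)) ∧
      ∀ j < s'.reg 5,
        (s'.mem 9 (i * m + l.getD j 0) = 0 ↔ beginsWith l ρ (i + 1) (l.getD j 0) = true) ∧
        (0 < s'.mem 10 (i * m + l.getD j 0) ↔ endsWith l ρ (i + 1) (l.getD j 0) = true)) ?_ ?_ ?_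
  · simp only [State.setReg_reg, State.setReg_mem, State.setMem_reg, State.setMem_mem,
      Nat.reduceEqDiff, reduceIte]
    exact ⟨by omega, by omega, by simp, by simp⟩
  · rintro s' b f ⟨hj, hbud, hold, hnew⟩ hlt
    have h' := (h.setReg 5 0).of_frame f
    have h7 : s'.mem 7 = s.mem 7 := f.mem 7 rfl
    have h14' : s'.reg 14 = i * m := (f.reg 14 rfl).trans h14
    have hlt : s'.reg 5 < l.length := h'.len ▸ hlt
    have hx := hmem _ (getD_mem hlt)
    have hbeg := beginsWith_getD (ρ := ρ) (i := i + 1) hlt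
    have hend := endsWith_getD (ρ := ρ) (i := i + 1) hlt
    obtain ⟨m1, m2⟩ := hmark (s'.reg 5) (by omega)
    obtain ⟨m3, m4⟩ := hmark (s'.reg 5 + 1) (by omega)
    rw [← m1] at hbeg
    rw [← m3] at hend
    refine ⟨by omega, ?_⟩
    simp only [wp_block_cons, wp_block_nil, wp_load, wp_store, wp_add]
    simp only [State.setReg_reg, State.setReg_mem, State.setMem_reg, State.setMem_mem,
      Nat.reduceEqDiff, reduceIte, h'.one, h7, h14', h'.word _ hlt]
    refine ⟨by omega, by omega, by omega, by omega, by omega, by omega, by omega, by omega,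
      by omega, by omega, by omega, by omega, by omega, by omega, by omega, by omega, by omega,
      fun t ht x hx => ?_, fun j hj => ?_⟩
    · have := hbelow t x (l.getD (s'.reg 5) 0) ht hx
      rw [Function.update_of_ne this, Function.update_of_ne this]
      exact hold t ht x hx
    -- A repeated occurrence overwrites the entry of its variable with marks of the same meaning.
    · by_cases hjx : l.getD j 0 = l.getD (s'.reg 5) 0
      · rw [hjx, Function.update_self, Function.update_self, hbeg, hend]
        omega
      · have hne : i * m + l.getD j 0 ≠ i * m + l.getD (s'.reg 5) 0 := by omega
        rw [Function.update_of_ne hne, Function.update_of_ne hne]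
        refine hnew j ?_
        rcases Nat.lt_succ_iff_lt_or_eq.1 hj with hj | rfl
        · exact hj
        · exact absurd rfl hjx
  · rintro s' b f ⟨hj, hbud, hold, hnew⟩ hge
    have h' := (h.setReg 5 0).of_frame f
    have h14' : s'.reg 14 = i * m := (f.reg 14 rfl).trans h14
    have h1' : s'.reg 1 = m := (f.reg 1 rfl).trans h1
    have hj : s'.reg 5 = l.length := le_antisymm hj (h'.len ▸ hge)
    simp only [wp_block_cons, wp_block_nil, wp_add]
    simp only [State.setReg_reg, State.setReg_mem, State.setMem_reg, State.setMem_mem,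
      Nat.reduceEqDiff, reduceIte, h14', h1']
    refine ⟨by omega, by omega, by omega, by omega, by simpa using h1', ?_, ?_, ?_⟩
    · simp [Nat.succ_mul]
    · intro t ht x hx
      simp only [State.setReg_reg, State.setReg_mem, State.setMem_reg, State.setMem_mem,
      Nat.reduceEqDiff, reduceIte]
      rcases Nat.lt_succ_iff_lt_or_eq.1 (Nat.lt_of_succ_lt_succ ht) with ht | rfl
      · rw [(hold t ht x (hm x (mem_level.1 hx).1)).1]
        exact hb t (by omega) x hx
      · rw [hl] at hx ⊢
        obtain ⟨j, hj', rfl⟩ := exists_getD_eq hx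
        exact (hnew j (by omega)).1
    · intro t ht x hx
      simp only [State.setReg_reg, State.setReg_mem, State.setMem_reg, State.setMem_mem,
      Nat.reduceEqDiff, reduceIte]
      rcases Nat.lt_succ_iff_lt_or_eq.1 (Nat.lt_of_succ_lt_succ ht) with ht | rfl
      · rw [(hold t ht x (hm x (mem_level.1 hx).1)).2]
        exact he t (by omega) x hx
      · rw [hl] at hx ⊢
        obtain ⟨j, hj', rfl⟩ := exists_getD_eq hx
        exact (hnew j (by omega)).2

/-! ### Writing the compressed words -/

/-- Appends the contents of the register `y` to the output. -/
def emitCmd (y : ℕ) : Cmd := block [.store 2 11 y, .add 11 11 2]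

/-- The output ends with the list `p`, and the registers needed for writing have the right
contents. -/
structure Writing (m d x : ℕ) (p : List ℕ) (s : State) : Prop where
  vars : s.reg 1 = m
  one : s.reg 2 = 1
  var : s.reg 6 = x
  rank : s.reg 7 = d + 1
  zero : s.reg 15 = 0
  out : Stores (s.mem 2) p
  pos : s.reg 11 = p.length

theorem wp_emitCmd {N m d x y v b : ℕ} {p : List ℕ} {s : State} {Q : State → ℕ → Prop}
    (h : Writing m d x p s) (hp : p.length < N) (hb : 3 ≤ b) (hv : s.reg y = v)
    (hQ : Writing m d x (p ++ [v]) ((s.setMem 2 p.length v).setReg 11 (p.length + 1)) →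
      Q ((s.setMem 2 p.length v).setReg 11 (p.length + 1)) (b - 3)) :
    wp N (emitCmd y) Q s b := by
  simp only [emitCmd, wp_block_cons, wp_block_nil, wp_store, wp_add]
  simp only [State.setReg_reg, State.setReg_mem, State.setMem_reg, State.setMem_mem,
      Nat.reduceEqDiff, reduceIte, h.one, h.pos, hv]
  refine ⟨hp, by omega, by omega, by omega, by omega, hQ ?_⟩
  exact ⟨h.vars, h.one, h.var, h.rank, h.zero, h.out.append rfl, by simp⟩

/-- Writes the part of a word before its largest letter. -/
def ascProg : Cmd := block [.const 4 1, .copy 9 6,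
  .loop 4 7 (block [.load 16 9 9, .ite 15 16 .skip (emitCmd 4), .add 9 9 1, .add 4 4 2])]

/-- Register `9` walks down column `x` in steps of `m`, where row `t` belongs to level `t + 1`. It
stops one row below the last one used, where `descProg` starts to walk back. -/
theorem run_ascProg {N m d x : ℕ} {p : List ℕ} {s : State} {β : ℕ → Bool}
    (h : Writing m d x p s) (hβ : ∀ t < d, s.mem 9 (t * m + x) = 0 ↔ β (t + 1) = true)
    (hx : d * m + x < N) (hd : d < N) (hp : p.length + d < N) :
    Run N ascProg s (9 * d + 5) fun s' =>
      Writing m d x (p ++ (List.range' 1 d).filter β) s' ∧ s'.reg 4 = d + 1 ∧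
        s'.reg 9 = d * m + x := by
  refine Run.of_wp ?_
  simp only [ascProg, wp_block_cons, wp_const, wp_copy]
  refine ⟨by omega, by omega, by omega, ?_⟩
  refine wp_loop (fun s' b => ∃ t ≤ d, 9 * (d - t) + 2 ≤ b ∧
      Writing m d x (p ++ (List.range' 1 t).filter β) s' ∧ s'.reg 4 = t + 1 ∧
        s'.reg 9 = t * m + x) ?_ ?_ ?_
  · refine ⟨0, by omega, by omega, ?_, by simp, by simp [h.var]⟩
    have := h.pos
    exact ⟨h.vars, h.one, h.var, h.rank, h.zero, by simpa using h.out, by simpa using this⟩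
  · rintro s' b f ⟨t, htd, hb, hw, h4, h9⟩ hlt
    rw [h4, hw.rank] at hlt
    have htd : t < d := by omega
    have m9 : s'.mem 9 = s.mem 9 := f.mem 9 rfl
    have hle : (t + 1) * m ≤ d * m := Nat.mul_le_mul_right m htd
    rw [Nat.succ_mul] at hle
    have hlen : ((List.range' 1 t).filter β).length ≤ t :=
      (List.length_filter_le _ _).trans (by simp)
    have hsucc : (List.range' 1 (t + 1)).filter β =
        (List.range' 1 t).filter β ++ if β (t + 1) then [t + 1] else [] := by
      rw [List.range'_concat, List.filter_append]
      cases hβt : β (t + 1) <;> simp [Nat.add_comm 1 t, hβt]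
    have hβt := hβ t htd
    refine ⟨by omega, ?_⟩
    simp only [wp_block_cons, wp_load, wp_ite, wp_skip]
    simp only [State.setReg_reg, State.setReg_mem, State.setMem_reg, State.setMem_mem,
      Nat.reduceEqDiff, reduceIte, hw.zero, h9, m9]
    refine ⟨by omega, by omega, by omega, fun hpos => ⟨by omega, ?_⟩, fun hz => ?_⟩
    · have hβf : β (t + 1) = false := by
        cases hc : β (t + 1)
        · rfl
        · rw [hc] at hβt
          have := hβt.2 rfl
          omega
      simp only [wp_block_cons, wp_block_nil, wp_add]
      simp only [State.setReg_reg, State.setReg_mem, State.setMem_reg, State.setMem_mem,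
      Nat.reduceEqDiff, reduceIte, h9, h4, hw.one, hw.vars]
      refine ⟨by omega, by omega, by omega, by omega, by omega, t + 1, htd, by omega, ?_, rfl, ?_⟩
      · rw [hsucc, hβf, if_neg (by simp), List.append_nil]
        exact ⟨hw.vars, hw.one, hw.var, hw.rank, hw.zero, hw.out, hw.pos⟩
      · rw [Nat.succ_mul]
        omega
    · have hβf : β (t + 1) = true := hβt.1 (by omega)
      have hw' : Writing m d x (p ++ (List.range' 1 t).filter β)
          (s'.setReg 16 (s.mem 9 (t * m + x))) :=
        ⟨hw.vars, hw.one, hw.var, hw.rank, hw.zero, hw.out, hw.pos⟩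
      refine wp_emitCmd (v := t + 1) hw' (by rw [List.length_append]; omega) (by omega)
        (by simpa using h4) fun hw₁ => ?_
      simp only [wp_block_cons, wp_block_nil, wp_add]
      simp only [State.setReg_reg, State.setReg_mem, State.setMem_reg, State.setMem_mem,
      Nat.reduceEqDiff, reduceIte, h9, h4, hw.one, hw.vars]
      refine ⟨by omega, by omega, by omega, by omega, by omega, t + 1, htd, by omega, ?_, rfl, ?_⟩
      · rw [hsucc, hβf, if_pos rfl, ← List.append_assoc]
        exact ⟨hw₁.vars, hw₁.one, hw₁.var, hw₁.rank, hw₁.zero, hw₁.out, hw₁.pos⟩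
      · rw [Nat.succ_mul]
        omega
  · rintro s' b f ⟨t, htd, hb, hw, h4, h9⟩ hge
    rw [h4, hw.rank] at hge
    obtain rfl : t = d := by omega
    rw [wp_block_nil]
    exact ⟨by omega, by omega, hw, h4, h9⟩

/-- Writes the part of a word after its largest letter. -/
def descProg : Cmd :=
  .loop 2 4 (block [.sub 4 4 2, .sub 9 9 1, .load 16 10 9, .ite 15 16 (emitCmd 4) .skip])

theorem run_descProg {N m d x : ℕ} {p : List ℕ} {s : State} {ε : ℕ → Bool}
    (h : Writing m d x p s) (hε : ∀ t < d, 0 < s.mem 10 (t * m + x) ↔ ε (t + 1) = true)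
    (h4 : s.reg 4 = d + 1) (h9 : s.reg 9 = d * m + x)
    (hx : d * m + x < N) (hp : p.length + d < N) :
    Run N descProg s (9 * d + 1) fun s' =>
      Writing m d x (p ++ ((List.range' 1 d).filter ε).reverse) s' := by
  refine Run.of_wp ?_
  refine wp_loop (fun s' b => ∃ t ≤ d, 9 * t + 1 ≤ b ∧
      Writing m d x (p ++ ((List.range' (t + 1) (d - t)).filter ε).reverse) s' ∧
        s'.reg 4 = t + 1 ∧ s'.reg 9 = t * m + x) ?_ ?_ ?_
  · exact ⟨d, le_rfl, le_rfl, by simpa using h, h4, h9⟩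
  · rintro s' b f ⟨t, htd, hb, hw, h4, h9⟩ hlt
    rw [h4, hw.one] at hlt
    obtain ⟨t, rfl⟩ : ∃ t', t = t' + 1 := ⟨t - 1, by omega⟩
    have m10 : s'.mem 10 = s.mem 10 := f.mem 10 rfl
    have hle : (t + 1) * m ≤ d * m := Nat.mul_le_mul_right m htd
    have hm : (t + 1) * m + x - m = t * m + x := by
      rw [Nat.succ_mul]
      omega
    rw [Nat.succ_mul] at hle
    have hlen : ((List.range' (t + 1 + 1) (d - (t + 1))).filter ε).reverse.length ≤ d - (t + 1) := by
      rw [List.length_reverse]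
      exact (List.length_filter_le _ _).trans (by simp)
    have hsucc : ((List.range' (t + 1) (d - t)).filter ε).reverse =
        ((List.range' (t + 1 + 1) (d - (t + 1))).filter ε).reverse ++
          if ε (t + 1) then [t + 1] else [] := by
      rw [show d - t = d - (t + 1) + 1 by omega, List.range'_succ]
      cases hεt : ε (t + 1) <;> simp [hεt]
    have hεt := hε t (by omega)
    refine ⟨by omega, ?_⟩
    simp only [wp_block_cons, wp_load, wp_ite, wp_skip, wp_sub]
    simp only [State.setReg_reg, State.setReg_mem, State.setMem_reg, State.setMem_mem,
      Nat.reduceEqDiff, reduceIte, hw.zero, hw.one, hw.vars, h9, h4, hm, m10, Nat.add_sub_cancel]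
    refine ⟨by omega, by omega, by omega, by omega, by omega, fun hpos => ?_,
      fun hz => ⟨by omega, ?_⟩⟩
    · have hεf : ε (t + 1) = true := hεt.1 hpos
      refine wp_emitCmd (m := m) (d := d) (x := x) (v := t + 1)
        (p := p ++ ((List.range' (t + 1 + 1) (d - (t + 1))).filter ε).reverse)
        ⟨hw.vars, hw.one, hw.var, hw.rank, hw.zero, hw.out, hw.pos⟩
        (by rw [List.length_append]; omega) (by omega) (by simp) fun hw₁ => ?_
      rw [wp_block_nil]
      refine ⟨by omega, t, by omega, by omega, ?_, by simp, by simp⟩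
      rw [hsucc, hεf, if_pos rfl, ← List.append_assoc]
      exact hw₁
    · have hεf : ε (t + 1) = false := by
        cases hc : ε (t + 1)
        · rfl
        · rw [hc] at hεt
          have := hεt.2 rfl
          omega
      rw [wp_block_nil]
      refine ⟨by omega, t, by omega, by omega, ?_, by simp, by simp⟩
      rw [hsucc, hεf, if_neg (by simp), List.append_nil]
      exact ⟨hw.vars, hw.one, hw.var, hw.rank, hw.zero, hw.out, hw.pos⟩
  · rintro s' b f ⟨t, htd, hb, hw, h4, h9⟩ hge
    rw [h4, hw.one] at hge
    obtain rfl : t = 0 := by omega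
    exact ⟨by omega, hw⟩

/-- The output for a variable of rank `r`. -/
def outWord (β ε : ℕ → Bool) (r : ℕ) : List ℕ :=
  (List.range' 1 (r - 1)).filter β ++ [r] ++ ((List.range' 1 (r - 1)).filter ε).reverse ++ [0]

/-- At most `r - 1` letters on each side, the largest letter and the end marker; so the whole output
fits into `2 * (m * k)` cells. -/
theorem length_outWord_le (β ε : ℕ → Bool) {r : ℕ} (hr : 1 ≤ r) :
    (outWord β ε r).length ≤ 2 * r := by
  have h1 := List.length_filter_le β (List.range' 1 (r - 1))
  have h2 := List.length_filter_le ε (List.range' 1 (r - 1))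
  rw [List.length_range'] at h1 h2
  simp only [outWord, List.length_append, List.length_reverse, List.length_singleton]
  omega

/-- Writes the words of all variables. -/
def outputProg : Cmd := block [.const 6 0, .const 11 0,
  .loop 6 1 (block [.load 7 1 6, ascProg, emitCmd 7, descProg, emitCmd 15, .add 6 6 2])]

theorem run_outputProg {N m k : ℕ} {ρ : ℕ → ℕ} {β ε : ℕ → ℕ → Bool} {s : State}
    (h1 : s.reg 1 = m) (h2 : s.reg 2 = 1) (h15 : s.reg 15 = 0) (hρ : ∀ x < m, s.mem 1 x = ρ x)
    (hρ1 : ∀ x < m, 1 ≤ ρ x) (hρk : ∀ x < m, ρ x ≤ k)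
    (hβ : ∀ x < m, ∀ t, t + 1 < ρ x → (s.mem 9 (t * m + x) = 0 ↔ β x (t + 1) = true))
    (hε : ∀ x < m, ∀ t, t + 1 < ρ x → (0 < s.mem 10 (t * m + x) ↔ ε x (t + 1) = true))
    (hN : 2 * (m * k) < N) :
    Run N outputProg s (m * (18 * k + 16) + 4) fun s' =>
      Stores (s'.mem 2) ((List.range m).flatMap fun x => outWord (β x) (ε x) (ρ x)) := by
  refine Run.of_wp ?_
  simp only [outputProg, wp_block_cons, wp_const]
  refine ⟨by omega, by omega, by omega, by omega, ?_⟩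
  refine wp_loop (fun s' b => ∃ x e, x + e = m ∧ s'.reg 6 = x ∧ e * (18 * k + 16) + 2 ≤ b ∧
      Stores (s'.mem 2) ((List.range x).flatMap fun x => outWord (β x) (ε x) (ρ x)) ∧
      s'.reg 11 = ((List.range x).flatMap fun x => outWord (β x) (ε x) (ρ x)).length ∧
      s'.reg 11 ≤ x * (2 * k)) ?_ ?_ ?_
  · exact ⟨0, m, by omega, by simp, by omega, Stores.nil _, by simp, by simp⟩
  · rintro s' b f ⟨x, e, hxe, h6, hb, hst, h11, hle⟩ hlt
    have e1 : s'.reg 1 = m := (f.reg 1 rfl).trans h1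
    have e2 : s'.reg 2 = 1 := (f.reg 2 rfl).trans h2
    have e15 : s'.reg 15 = 0 := (f.reg 15 rfl).trans h15
    have m1 : s'.mem 1 = s.mem 1 := f.mem 1 rfl
    have m9 : s'.mem 9 = s.mem 9 := f.mem 9 rfl
    have m10 : s'.mem 10 = s.mem 10 := f.mem 10 rfl
    rw [h6, e1] at hlt
    obtain ⟨e, rfl⟩ : ∃ e', e = e' + 1 := ⟨e - 1, by omega⟩
    have hβx := hβ x hlt
    have hεx := hε x hlt
    have hrk := hρk x hlt
    obtain ⟨d, hd⟩ : ∃ d, ρ x = d + 1 := ⟨ρ x - 1, by have := hρ1 x hlt; omega⟩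
    have hlen := length_outWord_le (β x) (ε x) (hρ1 x hlt)
    have hmk : m ≤ m * k := Nat.le_mul_of_pos_right m (by omega)
    have hkm : k ≤ m * k := Nat.le_mul_of_pos_left k (by omega)
    have hdm : d * m + x < m * k := by
      calc d * m + x < d * m + m := by omega
        _ = m * (d + 1) := by ring
        _ ≤ m * k := Nat.mul_le_mul_left m (by omega)
    have hxk : (x + 1) * (2 * k) ≤ 2 * (m * k) := by
      calc (x + 1) * (2 * k) ≤ m * (2 * k) := Nat.mul_le_mul_right _ hlt
        _ = 2 * (m * k) := by ring
    rw [Nat.succ_mul] at hb hxk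
    have hout : outWord (β x) (ε x) (ρ x) = (List.range' 1 d).filter (β x) ++ [d + 1] ++
        ((List.range' 1 d).filter (ε x)).reverse ++ [0] := by
      rw [outWord, hd, Nat.add_sub_cancel]
    rw [hd] at hβx hεx
    set p := (List.range x).flatMap fun x => outWord (β x) (ε x) (ρ x) with hpdef
    have hl1 : ((List.range' 1 d).filter (β x)).length ≤ d :=
      (List.length_filter_le _ _).trans (by simp)
    have hl2 : ((List.range' 1 d).filter (ε x)).reverse.length ≤ d := by
      rw [List.length_reverse]
      exact (List.length_filter_le _ _).trans (by simp)
    refine ⟨by omega, ?_⟩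
    rw [wp_block_cons, wp_load, h6, m1, hρ x hlt, wp_block_cons, hd]
    refine ⟨by omega, by omega, ?_⟩
    have w₀ : Writing m d x p (s'.setReg 7 (d + 1)) := ⟨e1, e2, h6, rfl, e15, hst, h11⟩
    refine (run_ascProg (N := N) (β := β x) w₀ (fun t ht => by rw [State.setReg_mem, m9]; exact hβx t (by omega))
      (by omega) (by omega) (by omega)).wp (by omega) fun s₁ b₁ f₁ hb₁ ⟨w₁, c4, c9⟩ => ?_
    have m9₁ : s₁.mem 10 = s.mem 10 := (f₁.mem 10 rfl).trans m10
    rw [wp_block_cons]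
    refine wp_emitCmd w₁ (by rw [List.length_append]; omega) (by omega) w₁.rank fun w₂ => ?_
    rw [wp_block_cons]
    refine (run_descProg (N := N) (ε := ε x) w₂
      (fun t ht => by simpa only [State.setReg_reg, State.setReg_mem, State.setMem_reg, State.setMem_mem,
      Nat.reduceEqDiff, reduceIte, m9₁] using hεx t (by omega)) (by simpa using c4)
      (by simpa using c9) (by omega)
      (by simp only [List.length_append, List.length_singleton]; omega)).wp (by omega)
      fun s₃ b₃ f₃ hb₃ w₃ => ?_
    rw [wp_block_cons]
    refine wp_emitCmd w₃ (by
      simp only [List.length_append, List.length_singleton]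
      omega) (by omega) w₃.zero fun w₄ => ?_
    have hfin : p ++ (List.range' 1 d).filter (β x) ++ [d + 1] ++
        ((List.range' 1 d).filter (ε x)).reverse ++ [0] =
        (List.range (x + 1)).flatMap fun x => outWord (β x) (ε x) (ρ x) := by
      rw [List.range_succ, List.flatMap_append, ← hpdef, List.flatMap_singleton, hout]
      simp only [List.append_assoc]
    rw [hfin] at w₄
    simp only [wp_block_cons, wp_block_nil, wp_add]
    rw [w₄.var, w₄.one]
    refine ⟨by omega, by omega, by omega, x + 1, e, by omega, rfl, by omega, w₄.out, w₄.pos, ?_⟩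
    rw [State.setReg_reg, if_neg (by omega), w₄.pos, ← hfin, List.append_assoc, List.append_assoc,
      List.append_assoc, List.length_append, ← List.append_assoc, ← List.append_assoc, ← hout,
      Nat.succ_mul]
    omega
  · rintro s' b f ⟨x, e, hxe, h6, hb, hst, h11, hle⟩ hge
    have e1 : s'.reg 1 = m := (f.reg 1 rfl).trans h1
    rw [h6, e1] at hge
    obtain rfl : x = m := by omega
    rw [wp_block_nil]
    exact ⟨by omega, by omega, hst⟩

/-! ### Translating between variables and numbers -/

/-- The rank of a variable that is given as a number. -/
def rankFun {m : ℕ} (R : Fin m → ℕ) (x : ℕ) : ℕ := (List.ofFn R).getD x 0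

theorem rankFun_val {m : ℕ} (R : Fin m → ℕ) (x : Fin m) : rankFun R x = R x := by
  simp [rankFun]

theorem rankFun_of_lt {m : ℕ} (R : Fin m → ℕ) {x : ℕ} (hx : x < m) :
    rankFun R x = R ⟨x, hx⟩ := rankFun_val R ⟨x, hx⟩

theorem solves_fin {m i : ℕ} {pat : List (Fin m)} {R : Fin m → ℕ} {b e : ℕ → Bool}
    (h : Solves (pat.map Fin.val) (rankFun R) i b e) :
    Solves pat R i (fun x => b x) (fun x => e x) := by
  have h' := solves_map.1 h
  rwa [show rankFun R ∘ Fin.val = R from funext (rankFun_val R)] at h'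

theorem IsRankedOccurrence.consistent {m k : ℕ} {pat : List (Fin m)} {R : Fin m → ℕ}
    {h : Fin m → List ℕ} (H : IsRankedOccurrence pat R k h) {i : ℕ} (hi : 1 ≤ i) :
    Consistent (level (pat.map Fin.val) (rankFun R) i) (rankFun R) i := by
  obtain ⟨i, rfl⟩ : ∃ i', i = i' + 1 := ⟨i - 1, by omega⟩
  obtain ⟨b, e, hs⟩ := H.exists_solves i
  -- The value outside the variables is arbitrary, as only variables occur in the pattern.
  let ext : (Fin m → Bool) → ℕ → Bool := fun b x => if hx : x < m then b ⟨x, hx⟩ else true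
  have hext : ∀ b, ext b ∘ Fin.val = b := fun b => funext fun x => by simp [ext]
  refine Solves.consistent (b := ext b) (e := ext e) (solves_map.2 ?_)
  rwa [hext, hext, show rankFun R ∘ Fin.val = R from funext (rankFun_val R)]

/-- The ranked occurrence that is read off the marks. -/
noncomputable def occurrence {m : ℕ} (pat : List (Fin m)) (R : Fin m → ℕ) (x : Fin m) : List ℕ :=
  valueWord (fun i => beginsWith (level (pat.map Fin.val) (rankFun R) i) (rankFun R) i x)
    (fun i => endsWith (level (pat.map Fin.val) (rankFun R) i) (rankFun R) i x) (R x)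

theorem isRankedOccurrence_occurrence {m k : ℕ} {pat : List (Fin m)} {R : Fin m → ℕ}
    (hR1 : ∀ x, 1 ≤ R x) (hRk : ∀ x, R x ≤ k)
    (h : ∀ i, 1 ≤ i → i ≤ k →
      Consistent (level (pat.map Fin.val) (rankFun R) i) (rankFun R) i) :
    IsRankedOccurrence pat R k (occurrence pat R) :=
  isRankedOccurrence_valueWord
    (b := fun i x => beginsWith (level (pat.map Fin.val) (rankFun R) i) (rankFun R) i x)
    (e := fun i x => endsWith (level (pat.map Fin.val) (rankFun R) i) (rankFun R) i x)
    hR1 hRk fun i h1 h2 => solves_fin (h i h1 h2).solves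

theorem exists_isRankedOccurrence_iff {m k : ℕ} {pat : List (Fin m)} {R : Fin m → ℕ}
    (hR1 : ∀ x, 1 ≤ R x) (hRk : ∀ x, R x ≤ k) :
    (∃ h, IsRankedOccurrence pat R k h) ↔ ∀ i, 1 ≤ i → i ≤ k →
      Consistent (level (pat.map Fin.val) (rankFun R) i) (rankFun R) i :=
  ⟨fun ⟨_, H⟩ _ hi _ => H.consistent hi, fun h => ⟨_, isRankedOccurrence_occurrence hR1 hRk h⟩⟩

theorem encodeWords_occurrence {m : ℕ} {pat : List (Fin m)} {R : Fin m → ℕ}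
    (hR1 : ∀ x, 1 ≤ R x) :
    encodeWords (fun x => compress (occurrence pat R x)) = (List.range m).flatMap fun x => outWord
      (fun i => beginsWith (level (pat.map Fin.val) (rankFun R) i) (rankFun R) i x)
      (fun i => endsWith (level (pat.map Fin.val) (rankFun R) i) (rankFun R) i x)
      (rankFun R x) := by
  rw [encodeWords, ← List.map_coe_finRange_eq_range, List.flatMap_map]
  congr 1
  funext x
  rw [occurrence, compress_valueWord _ _ (hR1 x), outWord, rankFun_val]

/-- Sets up the constants and computes the highest rank. -/
def initProg : Cmd := block [.const 2 1, .const 13 1, .const 4 1, maxProg, .add 18 3 2]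

/-! ### The complete programs and their running times -/

section programs

variable {m k N : ℕ} {pat : List (Fin m)} {R : Fin m → ℕ}

theorem card_le_length_of_forall_mem (hpat : ∀ x, x ∈ pat) : m ≤ pat.length := by
  calc m = (Finset.univ : Finset (Fin m)).card := by simp
    _ ≤ pat.toFinset.card := Finset.card_le_card fun x _ => by simpa using hpat x
    _ ≤ pat.length := List.toFinset_card_le pat

theorem run_initProg (hR : IsGreatest (Set.range R) k) (hm : m < N) (hn : pat.length + 2 ≤ N)
    (hk : k + 1 ≤ N) :
    Run N initProg (inputState pat R) (8 * m + 15) fun s =>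
      LevelInput N (pat.map Fin.val) (rankFun R) 1 s ∧ s.reg 13 = 1 ∧ s.reg 18 = k + 1 := by
  obtain ⟨⟨x₀, hx₀⟩, hmax⟩ := hR
  refine Run.of_wp ?_
  simp only [initProg, wp_block_cons, wp_const]
  refine ⟨by omega, by omega, by omega, by omega, by omega, by omega, ?_⟩
  refine (run_maxProg (m := m) (k := k) (ρ := rankFun R) rfl rfl (fun x _ => rfl) hm
    (fun x hx => ?_) ⟨x₀, x₀.2, (rankFun_val R x₀).trans hx₀⟩).wp (by omega)
    fun s₁ b₁ f₁ hb₁ h3 => ?_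
  · rw [rankFun_of_lt R hx]
    exact hmax ⟨_, rfl⟩
  have e0 : s₁.reg 0 = pat.length := f₁.reg 0 rfl
  have e2 : s₁.reg 2 = 1 := f₁.reg 2 rfl
  have e4 : s₁.reg 4 = 1 := f₁.reg 4 rfl
  have e13 : s₁.reg 13 = 1 := f₁.reg 13 rfl
  have e15 : s₁.reg 15 = 0 := f₁.reg 15 rfl
  have m0 : s₁.mem 0 = fun i => (pat.map Fin.val).getD i 0 := f₁.mem 0 rfl
  have m1 : s₁.mem 1 = rankFun R := f₁.mem 1 rfl
  simp only [wp_block_cons, wp_block_nil, wp_add]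
  simp only [State.setReg_reg, State.setReg_mem, State.setMem_reg, State.setMem_mem,
      Nat.reduceEqDiff, reduceIte, h3, e2]
  refine ⟨by omega, by omega, by omega, LevelInput.setReg ?_ 18 (k + 1), e13, trivial⟩
  refine ⟨by simpa using e0, e2, e4, e15, fun q hq => ?_, fun x _ => by rw [m1], ?_, by simpa using hn⟩
  · rw [m0]
    exact List.getD_eq_getElem _ _ hq
  · intro x hx
    obtain ⟨y, -, rfl⟩ := List.mem_map.1 hx
    omega

theorem fits_inputState (hR : IsGreatest (Set.range R) k) (hm : m ≤ N) (hn : pat.length ≤ N)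
    (hk : k ≤ N) : (inputState pat R).Fits N := by
  refine ⟨fun x => ?_, fun a i => ?_, fun a i hi => ?_⟩
  · simp only [inputState]
    split_ifs <;> omega
  · simp only [inputState]
    split_ifs
    · by_cases hi : i < pat.length
      · rw [List.getD_eq_getElem _ _ (by simpa using hi), List.getElem_map]
        omega
      · rw [List.getD_eq_default _ _ (by simpa using hi)]
        omega
    · by_cases hi : i < m
      · have := hR.2 ⟨⟨i, hi⟩, rfl⟩
        have h' := rankFun_of_lt R hi
        rw [rankFun] at h'
        omega
      · rw [List.getD_eq_default _ _ (by simpa using hi)]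
        omega
    · omega
  · simp only [inputState]
    split_ifs
    · exact List.getD_eq_default _ _ (by simpa using hn.trans hi)
    · exact List.getD_eq_default _ _ (by simpa using hm.trans hi)
    · rfl

/-- The program for the decision problem. -/
def decideProg : Cmd := block [initProg, levelsProg .skip, .copy 0 13]

theorem run_decideProg (hR1 : ∀ x, 1 ≤ R x) (hR : IsGreatest (Set.range R) k) (hm : m < N)
    (hn : pat.length + 2 ≤ N) (hk : k + 1 ≤ N) :
    Run N decideProg (inputState pat R) (8 * m + k * (74 * pat.length + 75) + 18) fun s =>
      s.reg 0 ≤ 1 ∧ (s.reg 0 = 1 ↔ ∃ h, IsRankedOccurrence pat R k h) := by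
  refine Run.of_wp ?_
  rw [decideProg, wp_block_cons]
  refine (run_initProg hR hm hn hk).wp (by omega) fun s₁ b₁ f₁ hb₁ ⟨hin, h13, h18⟩ => ?_
  have hlevels := run_levelsProg (τ := 1) (ext := .skip) (T := fun _ _ => True) hin h13 h18 hk
    trivial (fun _ _ _ _ _ _ _ _ => trivial) (fun _ _ => rfl) (fun _ _ => rfl)
    fun i s _ _ _ _ _ => Run.of_wp (wp_skip.2 ⟨le_rfl, trivial⟩)
  rw [List.length_map, show 74 * pat.length + 1 + 74 = 74 * pat.length + 75 from rfl] at hlevels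
  rw [wp_block_cons]
  refine hlevels.wp (by omega) fun s₂ b₂ f₂ hb₂ ⟨c1, c2, _⟩ => ?_
  simp only [wp_block_cons, wp_block_nil, wp_copy]
  refine ⟨by omega, by omega, by simpa using c2, ?_⟩
  rw [exists_isRankedOccurrence_iff hR1 fun x => hR.2 ⟨x, rfl⟩, ← c1]
  simp

/-- The program for the construction of a compressed instance. -/
def constructProg : Cmd := block [initProg, levelsProg recordProg, outputProg, .copy 0 13]

/-- The words are written in any case; they come from a ranked occurrence when the answer is `1`. -/
theorem run_constructProg (hpat : ∀ x, x ∈ pat) (hR1 : ∀ x, 1 ≤ R x)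
    (hR : IsGreatest (Set.range R) k) (hm : m < N) (hn : pat.length + 2 ≤ N) (hk : k + 1 ≤ N)
    (hmk : 2 * (m * k) < N) :
    Run N constructProg (inputState pat R)
      (8 * m + k * (83 * pat.length + 80) + m * (18 * k + 16) + 22) fun s =>
      s.reg 0 ≤ 1 ∧ (s.reg 0 = 1 ↔ ∃ h, IsRankedOccurrence pat R k h) ∧
        s.Holds 2 (encodeWords fun x => compress (occurrence pat R x)) := by
  have hRk : ∀ x, R x ≤ k := fun x => hR.2 ⟨x, rfl⟩
  have hlt : ∀ x ∈ pat.map Fin.val, x < m := by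
    intro x hx
    obtain ⟨y, -, rfl⟩ := List.mem_map.1 hx
    exact y.2
  -- Every variable occurs, so it is present on all levels up to its rank and all table entries that
  -- are read have been written.
  have hmem : ∀ x < m, ∀ i, i ≤ rankFun R x →
      x ∈ level (pat.map Fin.val) (rankFun R) i :=
    fun x hx i hi => mem_level.2 ⟨List.mem_map.2 ⟨⟨x, hx⟩, hpat _, rfl⟩, hi⟩
  refine Run.of_wp ?_
  rw [constructProg, wp_block_cons]
  refine (run_initProg hR hm hn hk).wp (by omega) fun s₁ b₁ f₁ hb₁ ⟨hin, h13, h18⟩ => ?_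
  have e1 : s₁.reg 1 = m := f₁.reg 1 rfl
  have e14 : s₁.reg 14 = 0 := f₁.reg 14 rfl
  have m1 : s₁.mem 1 = rankFun R := f₁.mem 1 rfl
  have hlevels := run_levelsProg (N := N) (ext := recordProg)
    (T := Tables (pat.map Fin.val) (rankFun R) m) hin h13 h18 hk
    ⟨e1, by omega, fun t ht => by omega, fun t ht => by omega⟩
    (fun i s s' h1 h2 h3 h4 hT => ⟨h1.trans hT.vars, by rw [h2]; exact hT.offset,
      by rw [h3]; exact hT.before, by rw [h4]; exact hT.behind⟩)
    (by decide) (by decide)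
    fun i s h1 h2 hT hr hmark => run_recordProg h1 h2 hT hr hmark hlt (by omega)
  rw [List.length_map, show 74 * pat.length + (9 * pat.length + 6) + 74 = 83 * pat.length + 80 by
    ring] at hlevels
  rw [wp_block_cons]
  refine hlevels.wp (by omega) fun s₂ b₂ f₂ hb₂ ⟨c1, c2, hT⟩ => ?_
  have m1' : s₂.mem 1 = rankFun R := (f₂.mem 1 rfl).trans m1
  have hin₂ : s₂.reg 2 = 1 ∧ s₂.reg 15 = 0 :=
    ⟨(f₂.reg 2 rfl).trans hin.one, (f₂.reg 15 rfl).trans hin.zero⟩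
  rw [wp_block_cons]
  have hle : ∀ x < m, rankFun R x ≤ k := fun x hx => by rw [rankFun_of_lt R hx]; exact hRk _
  refine (run_outputProg (N := N) (k := k) (ρ := rankFun R)
    (β := fun x i => beginsWith (level (pat.map Fin.val) (rankFun R) i) (rankFun R) i x)
    (ε := fun x i => endsWith (level (pat.map Fin.val) (rankFun R) i) (rankFun R) i x)
    hT.vars hin₂.1 hin₂.2 (fun x _ => by rw [m1']) (fun x hx => by rw [rankFun_of_lt R hx]; exact hR1 _)
    hle (fun x hx t ht => hT.before t (by have := hle x hx; omega) x (hmem x hx _ ht.le))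
    (fun x hx t ht => hT.behind t (by have := hle x hx; omega) x (hmem x hx _ ht.le)) hmk).wp
    (by omega) fun s₃ b₃ f₃ hb₃ hout => ?_
  have e13 : s₃.reg 13 = s₂.reg 13 := f₃.reg 13 rfl
  simp only [wp_block_cons, wp_block_nil, wp_copy]
  refine ⟨by omega, by omega, by simpa [e13] using c2, ?_, ?_⟩
  · rw [exists_isRankedOccurrence_iff hR1 hRk, ← c1]
    simp [e13]
  · rw [encodeWords_occurrence hR1]
    exact hout

end programs

end RankedZimin

/-- Ranked pattern matching in the Zimin word `Z_k`: `n` is the length of the pattern, `m` the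
number of its variables, `k` the highest rank. The first part is the decision problem, the second
part the construction of a compressed instance. The program and the constant do not depend on
the input. -/
theorem mainTheorem1 :
    (∃ (P : Cmd) (C : ℕ), ∀ (n m k : ℕ) (pat : List (Fin m)) (R : Fin m → ℕ),
      pat.length = n → (∀ x, x ∈ pat) → (∀ x, 1 ≤ R x) → IsGreatest (Set.range R) k →
      ∃ s : State,
        P.RunsWithin (C * (n * k)) (C * (n + k ^ 2)) (inputState pat R) s ∧
        ((∃ h, IsRankedOccurrence pat R k h) → s.reg 0 = 1) ∧
        ((¬ ∃ h, IsRankedOccurrence pat R k h) → s.reg 0 = 0)) ∧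
    (∃ (P : Cmd) (C : ℕ), ∀ (n m k : ℕ) (pat : List (Fin m)) (R : Fin m → ℕ),
      pat.length = n → (∀ x, x ∈ pat) → (∀ x, 1 ≤ R x) → IsGreatest (Set.range R) k →
      ∃ s : State,
        P.RunsWithin (C * (n * k)) (C * (n + m * k)) (inputState pat R) s ∧
        (m ≤ k → P.RunsWithin (C * (n * k)) (C * (n + k ^ 2)) (inputState pat R) s) ∧
        ((∃ h, IsRankedOccurrence pat R k h) → s.reg 0 = 1 ∧
          ∃ h, IsRankedOccurrence pat R k h ∧
            s.Holds 2 (encodeWords fun x => compress (h x))) ∧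
        ((¬ ∃ h, IsRankedOccurrence pat R k h) → s.reg 0 = 0)) := by
  -- As a highest rank exists, there is a variable. The resulting inequalities let `n * k` absorb
  -- all lower terms of the running times.
  have hinput : ∀ {n m k : ℕ} {pat : List (Fin m)} {R : Fin m → ℕ}, pat.length = n →
      (∀ x, x ∈ pat) → (∀ x, 1 ≤ R x) → IsGreatest (Set.range R) k → m ≤ n ∧ 1 ≤ m ∧ 1 ≤ k := by
    rintro n m k pat R rfl hpat hR1 ⟨⟨x, rfl⟩, -⟩
    have := x.2
    exact ⟨card_le_length_of_forall_mem hpat, by omega, hR1 x⟩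
  refine ⟨⟨decideProg, decideProg.regs.card + 4 * decideProg.arrays.card + 200,
    fun n m k pat R hlen hpat hR1 hR => ?_⟩,
    ⟨constructProg, constructProg.regs.card + 8 * constructProg.arrays.card + 300,
    fun n m k pat R hlen hpat hR1 hR => ?_⟩⟩
  · obtain ⟨hmn, hm, hk⟩ := hinput hlen hpat hR1 hR
    -- The memory parameter must allow for the gaps of the pattern and for a level counter that runs
    -- up to `k + 1`.
    obtain ⟨t, s, hexec, ht, hbit, hans⟩ := run_decideProg (N := n + k + 3) (pat := pat) hR1 hR
      (by omega) (by omega) (by omega)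
    refine ⟨s, ⟨n + k + 3, t, fits_inputState hR (by omega) (by omega) (by omega), hexec,
      ht.trans ?_, ?_⟩, hans.2, fun h => ?_⟩
    · have h1 : k * (74 * pat.length + 75) = 74 * (n * k) + 75 * k := by rw [hlen]; ring
      have h2 : n ≤ n * k := Nat.le_mul_of_pos_right n hk
      have h3 : k ≤ n * k := Nat.le_mul_of_pos_left k (by omega)
      calc _ ≤ 200 * (n * k) := by omega
        _ ≤ _ := Nat.mul_le_mul_right _ (by omega)
    · have h1 : n + k + 3 ≤ 4 * (n + k ^ 2) := by nlinarith
      have h2 : 1 ≤ n + k ^ 2 := by omega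
      rw [Cmd.space]
      generalize n + k ^ 2 = S at *
      nlinarith [Nat.mul_le_mul_left decideProg.arrays.card h1,
        Nat.mul_le_mul_left decideProg.regs.card h2]
    · have := mt hans.1 h
      omega
  · obtain ⟨hmn, hm, hk⟩ := hinput hlen hpat hR1 hR
    have hmk : k ≤ m * k := Nat.le_mul_of_pos_left k hm
    -- The additional `2 * (m * k)` makes room for the output, and thereby also for the tables with
    -- `m * k` entries.
    obtain ⟨t, s, hexec, ht, hbit, hans, hout⟩ := run_constructProg (N := n + 2 * (m * k) + k + 3)
      (pat := pat) hpat hR1 hR (by omega) (by omega) (by omega) (by omega)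
    have hruns : ∀ S, n + m * k ≤ S → constructProg.RunsWithin
        ((constructProg.regs.card + 8 * constructProg.arrays.card + 300) * (n * k))
        ((constructProg.regs.card + 8 * constructProg.arrays.card + 300) * S)
        (inputState pat R) s := by
      intro S hS
      refine ⟨n + 2 * (m * k) + k + 3, t,
        fits_inputState hR (by omega) (by omega) (by omega), hexec, ht.trans ?_, ?_⟩
      · have h1 : k * (83 * pat.length + 80) = 83 * (n * k) + 80 * k := by rw [hlen]; ring
        have h2 : n ≤ n * k := Nat.le_mul_of_pos_right n hk
        have h3 : k ≤ n * k := Nat.le_mul_of_pos_left k (by omega)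
        have h4 : m * (18 * k + 16) = 18 * (m * k) + 16 * m := by ring
        have h5 : m * k ≤ n * k := Nat.mul_le_mul_right k hmn
        calc _ ≤ 300 * (n * k) := by omega
          _ ≤ _ := Nat.mul_le_mul_right _ (by omega)
      · have h1 : n + 2 * (m * k) + k + 3 ≤ 8 * S := by omega
        have h2 : 1 ≤ S := by omega
        rw [Cmd.space]
        nlinarith [Nat.mul_le_mul_left constructProg.arrays.card h1,
          Nat.mul_le_mul_left constructProg.regs.card h2]
    refine ⟨s, hruns _ le_rfl, fun hmk' => hruns _ ?_, fun h => ⟨hans.2 h, occurrence pat R, ?_, hout⟩,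
      fun h => ?_⟩
    · rw [sq]
      exact Nat.add_le_add_left (Nat.mul_le_mul_right k hmk') n
    · have hRk : ∀ x, R x ≤ k := fun x => hR.2 ⟨x, rfl⟩
      exact isRankedOccurrence_occurrence hR1 hRk ((exists_isRankedOccurrence_iff hR1 hRk).1 h)
    · have := mt hans.1 h
      omega
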